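/- Let $d$ be a dimension and let $W:\mathbb{R}^d\to\mathbb{R}$ satisfy: (A) $W$ is continuous, $W(-x)=W(x)$ for all $x$, $W(0)=0$, and $W\in C^1(\mathbb{R}^d\setminus\{0\})$; (B) there is a constant $C>0$ with $W(z)\le C(1+|z|^2)$ for all $z\in\mathbb{R}^d$; (C') there are $\lambda',\lambda''\ge 0$ such that $x\mapsto W(x)+\frac{\lambda''}{2}|x|^2+\lambda'|x|$ is convex. Let $\mathcal{P}_2(\mathbb{R}^d)$ be the set of Borel probability measures on $\mathbb{R}^d$ with finite second moment, $W_2$ the quadratic Wasserstein distance on it, and $\Gamma_0(\mu,\nu)$ the set of optimal transport plans between $\mu$ and $\nu$ for the cost $|x-y|^2$. For $\mu\in\mathcal{P}_2(\mathbb{R}^d)$ put $$\mathcal{W}[\mu]=\frac12\int_{\mathbb{R}^d\times\mathbb{R}^d}W(x-y)\,d\mu(x)\,d\mu(y),$$ and let the subdifferential $\partial\mathcal{W}[\mu]$ be the set of vector fields $v\in L^2(\mu;\mathbb{R}^d)$ such that $$\mathcal{W}[\nu]-\mathcal{W}[\mu]\ \ge\ \inf_{\gamma\in\Gamma_0(\mu,\nu)}\int_{\mathbb{R}^d\times\mathbb{R}^d}v(x)\cdot(y-x)\,d\gamma(x,y)+o\bigl(W_2(\mu,\nu)\bigr)\qquad\text{as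 }W_2(\mu,\nu)\to0,\ \nu\in\mathcal{P}_2(\mathbb{R}^d).$$ Let $\mu\in\mathcal{P}_2(\mathbb{R}^d)$ be such that $\partial\mathcal{W}[\mu]\ne\varnothing$. Then the vector field $$k(x)=\int_{\{y\neq x\}}\nabla W(x-y)\,d\mu(y)$$ (where the integral converges absolutely for every $x\in\mathbb{R}^d$) is the element of minimal $L^2(\mu)$-norm of $\partial\mathcal{W}[\mu]$: one has $k\in\partial\mathcal{W}[\mu]$, $\|k\|_{L^2(\mu)}\le\|v\|_{L^2(\mu)}$ for every $v\in\partial\mathcal{W}[\mu]$, and equality of the norms implies $v=k$ $\mu$-almost everywhere. -/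

import Mathlib

open MeasureTheory
open scoped ENNReal

namespace InteractionEnergy

/-- The space `ℝ^d` with its Euclidean norm. -/
abbrev E (d : ℕ) : Type := EuclideanSpace ℝ (Fin d)

noncomputable section

/-- `μ ∈ 𝒫₂(ℝ^d)`: Borel probability measures with finite second moment. -/
structure MemP2 {d : ℕ} (μ : Measure (E d)) : Prop where
  isProbabilityMeasure : IsProbabilityMeasure μ
  lintegral_sq_lt_top : ∫⁻ x, ‖x‖ₑ ^ 2 ∂μ < ∞

/-- `Γ(μ, ν)`: the transport plans between `μ` and `ν`. -/
def plans {d : ℕ} (μ ν : Measure (E d)) : Set (Measure (E d × E d)) :=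
  {γ | γ.map Prod.fst = μ ∧ γ.map Prod.snd = ν}

/-- The quadratic cost `∫ |x - y|² dγ(x, y)` of a plan, with values in `[0, ∞]`. -/
def cost {d : ℕ} (γ : Measure (E d × E d)) : ℝ≥0∞ :=
  ∫⁻ p, ‖p.1 - p.2‖ₑ ^ 2 ∂γ

/-- `Γ₀(μ, ν)`: the optimal transport plans, i.e. the plans of minimal cost. -/
def optimalPlans {d : ℕ} (μ ν : Measure (E d)) : Set (Measure (E d × E d)) :=
  {γ | γ ∈ plans μ ν ∧ ∀ γ' ∈ plans μ ν, cost γ ≤ cost γ'}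

/-- The quadratic Wasserstein distance; the infimum is a finite number (and a minimum) for
`μ, ν ∈ 𝒫₂(ℝ^d)`. -/
def W2 {d : ℕ} (μ ν : Measure (E d)) : ℝ :=
  Real.sqrt (⨅ γ ∈ plans μ ν, cost γ).toReal

/-- The (Fréchet) subdifferential of `φ : 𝒫₂(ℝ^d) → ℝ` at `μ`: the vector fields `v ∈ L²(μ)` with
`φ(ν) - φ(μ) ≥ inf_{γ ∈ Γ₀(μ, ν)} ∫ ⟨v(x), y - x⟩ dγ(x, y) + o(W₂(μ, ν))` as `ν → μ` in
`𝒫₂(ℝ^d)`. For `v ∈ L²(μ)` and `ν ∈ 𝒫₂(ℝ^d)` the infimum is over a nonempty bounded set. -/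
def subdifferential {d : ℕ} (φ : Measure (E d) → ℝ) (μ : Measure (E d)) : Set (E d → E d) :=
  {v | MemLp v 2 μ ∧
    ∀ ε : ℝ, 0 < ε → ∃ δ : ℝ, 0 < δ ∧ ∀ ν : Measure (E d), MemP2 ν → W2 μ ν < δ →
      sInf ((fun γ : Measure (E d × E d) => ∫ p, inner ℝ (v p.1) (p.2 - p.1) ∂γ) ''
          optimalPlans μ ν) - ε * W2 μ ν
        ≤ φ ν - φ μ}

/-- Assumptions A, B and C' on the interaction potential. -/
structure IsAdmissible {d : ℕ} (W : E d → ℝ) : Prop where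
  continuous : Continuous W
  even : ∀ x, W (-x) = W x
  zero : W 0 = 0
  contDiffOn : ContDiffOn ℝ 1 W {0}ᶜ
  growth : ∃ C : ℝ, 0 < C ∧ ∀ z, W z ≤ C * (1 + ‖z‖ ^ 2)
  convex : ∃ l' l'' : ℝ, 0 ≤ l' ∧ 0 ≤ l'' ∧
    ConvexOn ℝ Set.univ (fun x => W x + l'' / 2 * ‖x‖ ^ 2 + l' * ‖x‖)

/-- The interaction energy `𝒲[μ] = ½ ∫∫ W(x - y) dμ(x) dμ(y)`. -/
def energy {d : ℕ} (W : E d → ℝ) (μ : Measure (E d)) : ℝ :=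
  (1 / 2) * ∫ p, W (p.1 - p.2) ∂(μ.prod μ)

/-- The vector field `k(x) = ∫_{y ≠ x} ∇W(x - y) dμ(y)`. -/
def field {d : ℕ} (W : E d → ℝ) (μ : Measure (E d)) (x : E d) : E d :=
  ∫ y in {x}ᶜ, gradient W (x - y) ∂μ

end

end InteractionEnergy

open Filter Topology
open scoped NNReal

namespace InteractionEnergy

/-! ### Optimal transport plans -/

/-! Write μ as the law of `X` and a competitor as the law of `X + H`. The difference of the energies
equals the integral of `⟨k(X), H⟩`, where `k = field W μ`, plus half the integral of the Taylor
remainder of `W` over independent pairs (`energy_map_add_sub`). Everything depends on controlling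
this remainder to first order.

From below: away from the origin, convexity up to `l'' / 2 * ‖x‖ ^ 2 + l' * ‖x‖` makes the remainder
at least quadratic, with a constant that degenerates only near the origin, and pairs at small
positive distance have small mass. Pairs with equal first points give `W` itself, which may have a
negative cusp such as `-‖x‖`. They are harmless if μ has no atoms, or if `W z ≥ -(l'' / 2 * ‖z‖ ^
2)`; in either case `k` satisfies the subgradient inequality along every optimal plan
(`energy_sub_ge_of_optimalPlan`).

If μ has an atom, a nonempty subdifferential forces that bound on `W` (`potential_ge_of_atom`).
Otherwise, sending half of the atom by `t • z` and half by `-(t • z)` lowers the energy linearly in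
`t`. Optimal plans onto the split measure keep the barycentre and carry only a vanishing fraction of
`t ^ 2` in cost outside the atom, so the pairing with any `v` is `o(t)`, a contradiction.

Minimality comes from testing `v` against the law of `x - t • k x`: the energy drops by `t * ‖k‖ ^
2` to first order, while Cauchy–Schwarz allows a drop of at most `t * ‖v‖ * ‖k‖`
(`integral_norm_sq_field_le`). For uniqueness, the midpoint of `k` and `v` is again in the
subdifferential, hence has norm at least that of `k`, and the parallelogram law concludes. -/

lemma measurable_costIntegrand {d : ℕ} :
    Measurable fun p : E d × E d => ‖p.1 - p.2‖ₑ ^ 2 := by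
  fun_prop

lemma isProbabilityMeasure_of_mem_plans {d : ℕ} {μ ν : Measure (E d)} [IsProbabilityMeasure μ]
    {γ : Measure (E d × E d)} (hγ : γ ∈ plans μ ν) : IsProbabilityMeasure γ := by
  constructor
  have h : (γ.map Prod.fst) Set.univ = 1 := by rw [hγ.1]; simp
  rwa [Measure.map_apply measurable_fst MeasurableSet.univ, Set.preimage_univ] at h

lemma prod_mem_plans {d : ℕ} (μ ν : Measure (E d)) [IsProbabilityMeasure μ]
    [IsProbabilityMeasure ν] : μ.prod ν ∈ plans μ ν := by
  constructor
  · simp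
  · simp

/-- The truncated quadratic cost as a bounded continuous function. -/
noncomputable def truncCost (d : ℕ) (n : ℕ) : BoundedContinuousFunction (E d × E d) ℝ≥0 :=
  BoundedContinuousFunction.mkOfBound
    ⟨fun p => min (‖p.1 - p.2‖₊ ^ 2) n, by fun_prop⟩ n (by
      intro p q
      rw [NNReal.dist_eq, abs_le]
      have h1 : ((min (‖p.1 - p.2‖₊ ^ 2) (n : ℝ≥0) : ℝ≥0) : ℝ) ≤ n := by
        exact_mod_cast min_le_right _ _
      have h2 : ((min (‖q.1 - q.2‖₊ ^ 2) (n : ℝ≥0) : ℝ≥0) : ℝ) ≤ n := by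
        exact_mod_cast min_le_right _ _
      have h3 := (min (‖p.1 - p.2‖₊ ^ 2) (n : ℝ≥0)).coe_nonneg
      have h4 := (min (‖q.1 - q.2‖₊ ^ 2) (n : ℝ≥0)).coe_nonneg
      constructor
      · simp only [ContinuousMap.coe_mk]; linarith
      · simp only [ContinuousMap.coe_mk]; linarith)

lemma truncCost_apply (d n : ℕ) (p : E d × E d) :
    (truncCost d n p : ℝ≥0∞) = min (‖p.1 - p.2‖ₑ ^ 2) n := by
  change ((min (‖p.1 - p.2‖₊ ^ 2) (n : ℝ≥0) : ℝ≥0) : ℝ≥0∞) = _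
  rw [ENNReal.coe_min]
  simp [enorm_eq_nnnorm]

/-- Monotone convergence. Each truncation is weakly continuous in the plan, so the cost becomes a
supremum of continuous functionals, hence lower semicontinuous. -/
lemma cost_eq_iSup {d : ℕ} (γ : Measure (E d × E d)) :
    cost γ = ⨆ n : ℕ, ∫⁻ p, truncCost d n p ∂γ := by
  simp_rw [truncCost_apply]
  rw [cost, ← lintegral_iSup]
  · congr 1 with p
    refine le_antisymm ?_ (iSup_le fun n => min_le_left _ _)
    have hp : ‖p.1 - p.2‖ₑ ^ 2 ≠ ∞ := ENNReal.pow_ne_top enorm_ne_top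
    obtain ⟨n, hn⟩ := ENNReal.exists_nat_gt hp
    exact le_iSup_of_le n (le_min le_rfl hn.le)
  · intro n
    exact measurable_costIntegrand.min measurable_const
  · intro n m h p
    exact min_le_min_left _ (by exact_mod_cast h)

lemma lowerSemicontinuous_cost {d : ℕ} :
    LowerSemicontinuous fun π : ProbabilityMeasure (E d × E d) =>
      cost (π : Measure (E d × E d)) := by
  simp_rw [cost_eq_iSup]
  refine lowerSemicontinuous_iSup fun n => Continuous.lowerSemicontinuous ?_
  rw [continuous_iff_continuousAt]
  intro π
  exact (ProbabilityMeasure.tendsto_iff_forall_lintegral_tendsto.1 tendsto_id) (truncCost d n)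

/-- Prokhorov: fixing both marginals is a weakly closed condition, and tightness of the two
marginals gives tightness of all their couplings through products of compact sets. -/
lemma isCompact_plans {d : ℕ} (μ ν : Measure (E d)) [IsProbabilityMeasure μ]
    [IsProbabilityMeasure ν] :
    IsCompact {π : ProbabilityMeasure (E d × E d) | (π : Measure (E d × E d)) ∈ plans μ ν} := by
  set S := {π : ProbabilityMeasure (E d × E d) | (π : Measure (E d × E d)) ∈ plans μ ν}
  have hclosed : IsClosed S := by
    have h1 := ProbabilityMeasure.continuous_map (Ω := E d × E d) (Ω' := E d) continuous_fst
    have h2 := ProbabilityMeasure.continuous_map (Ω := E d × E d) (Ω' := E d) continuous_snd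
    have hS : S = {π | ProbabilityMeasure.map π continuous_fst.measurable.aemeasurable
        = (⟨μ, inferInstance⟩ : ProbabilityMeasure (E d))} ∩
        {π | ProbabilityMeasure.map π continuous_snd.measurable.aemeasurable
        = (⟨ν, inferInstance⟩ : ProbabilityMeasure (E d))} := by
      ext π
      exact ⟨fun h => ⟨Subtype.ext h.1, Subtype.ext h.2⟩,
        fun h => ⟨congrArg Subtype.val h.1, congrArg Subtype.val h.2⟩⟩
    rw [hS]
    exact (isClosed_eq h1 continuous_const).inter (isClosed_eq h2 continuous_const)
  rw [← hclosed.closure_eq]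
  apply isCompact_closure_of_isTightMeasureSet
  rw [isTightMeasureSet_iff_exists_isCompact_measure_compl_le]
  intro ε hε
  have hε2 : 0 < ε / 2 := ENNReal.half_pos hε.ne'
  obtain ⟨K, hK, hKμ⟩ := isTightMeasureSet_iff_exists_isCompact_measure_compl_le.1
    (isTightMeasureSet_singleton (μ := μ)) _ hε2
  obtain ⟨L, hL, hLν⟩ := isTightMeasureSet_iff_exists_isCompact_measure_compl_le.1
    (isTightMeasureSet_singleton (μ := ν)) _ hε2
  refine ⟨K ×ˢ L, hK.prod hL, ?_⟩
  rintro _ ⟨π, hπ, rfl⟩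
  have hsub : (K ×ˢ L)ᶜ ⊆ Prod.fst ⁻¹' Kᶜ ∪ Prod.snd ⁻¹' Lᶜ := by
    rintro ⟨x, y⟩ h
    simp only [Set.mem_compl_iff, Set.mem_prod, not_and_or] at h
    exact h
  calc (π : Measure (E d × E d)) (K ×ˢ L)ᶜ
      ≤ (π : Measure (E d × E d)) (Prod.fst ⁻¹' Kᶜ)
        + (π : Measure (E d × E d)) (Prod.snd ⁻¹' Lᶜ) :=
        (measure_mono hsub).trans (measure_union_le _ _)
    _ = μ Kᶜ + ν Lᶜ := by
        rw [← Measure.map_apply measurable_fst hK.measurableSet.compl,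
          ← Measure.map_apply measurable_snd hL.measurableSet.compl, hπ.1, hπ.2]
    _ ≤ ε / 2 + ε / 2 := add_le_add (hKμ μ rfl) (hLν ν rfl)
    _ = ε := ENNReal.add_halves ε

theorem optimalPlans_nonempty {d : ℕ} (μ ν : Measure (E d)) [IsProbabilityMeasure μ]
    [IsProbabilityMeasure ν] : (optimalPlans μ ν).Nonempty := by
  obtain ⟨π, hπ, hmin⟩ := LowerSemicontinuousOn.exists_isMinOn
    (s := {π : ProbabilityMeasure (E d × E d) | (π : Measure (E d × E d)) ∈ plans μ ν})
    ⟨⟨μ.prod ν, inferInstance⟩, prod_mem_plans μ ν⟩ (isCompact_plans μ ν)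
    (lowerSemicontinuous_cost.lowerSemicontinuousOn _)
  refine ⟨π, hπ, fun γ hγ => ?_⟩
  have := isProbabilityMeasure_of_mem_plans hγ
  exact hmin (show (⟨γ, this⟩ : ProbabilityMeasure (E d × E d)) ∈ _ from hγ)

lemma iInf_cost_eq {d : ℕ} {μ ν : Measure (E d)} {γ : Measure (E d × E d)}
    (hγ : γ ∈ optimalPlans μ ν) : ⨅ γ ∈ plans μ ν, cost γ = cost γ :=
  le_antisymm (iInf₂_le _ hγ.1) (le_iInf₂ fun γ' hγ' => hγ.2 γ' hγ')

/-! ### Square integrability of plans -/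

lemma MemP2.memLp_id {d : ℕ} {μ : Measure (E d)} (hμ : MemP2 μ) : MemLp (fun x => x) 2 μ := by
  refine ⟨by fun_prop, ?_⟩
  rw [eLpNorm_lt_top_iff_lintegral_rpow_enorm_lt_top (by simp) (by simp)]
  simpa using hμ.lintegral_sq_lt_top

lemma memP2_map {d : ℕ} {Ω : Type*} [MeasurableSpace Ω] {P : Measure Ω} [IsProbabilityMeasure P]
    {Z : Ω → E d} (hZm : Measurable Z) (hZ : MemLp Z 2 P) : MemP2 (P.map Z) := by
  refine ⟨Measure.isProbabilityMeasure_map hZm.aemeasurable, ?_⟩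
  rw [lintegral_map (by fun_prop) hZm]
  have := (eLpNorm_lt_top_iff_lintegral_rpow_enorm_lt_top (by simp) (by simp)).1 hZ.2
  simpa using this

lemma memLp_fst_of_mem_plans {d : ℕ} {μ ν : Measure (E d)} (hμ : MemP2 μ)
    {γ : Measure (E d × E d)} (hγ : γ ∈ plans μ ν) : MemLp (fun p => p.1) 2 γ := by
  have := hμ.memLp_id
  rw [← hγ.1] at this
  exact (memLp_map_measure_iff (f := Prod.fst) (g := fun x : E d => x) (by fun_prop)
    (by fun_prop)).1 this

lemma memLp_snd_of_mem_plans {d : ℕ} {μ ν : Measure (E d)} (hν : MemP2 ν)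
    {γ : Measure (E d × E d)} (hγ : γ ∈ plans μ ν) : MemLp (fun p => p.2) 2 γ := by
  have := hν.memLp_id
  rw [← hγ.2] at this
  exact (memLp_map_measure_iff (f := Prod.snd) (g := fun x : E d => x) (by fun_prop)
    (by fun_prop)).1 this

lemma toReal_cost {d : ℕ} (γ : Measure (E d × E d)) :
    (cost γ).toReal = ∫ p, ‖p.2 - p.1‖ ^ 2 ∂γ := by
  rw [integral_eq_lintegral_of_nonneg_ae (ae_of_all _ fun p => by positivity) (by fun_prop), cost]
  congr 1
  refine lintegral_congr fun p => ?_
  rw [ENNReal.ofReal_pow (norm_nonneg _), ofReal_norm, enorm_sub_rev]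

lemma cost_lt_top {d : ℕ} {μ ν : Measure (E d)} (hμ : MemP2 μ) (hν : MemP2 ν)
    {γ : Measure (E d × E d)} (hγ : γ ∈ plans μ ν) : cost γ < ∞ := by
  have h := (memLp_fst_of_mem_plans hμ hγ).sub (memLp_snd_of_mem_plans hν hγ)
  have := (eLpNorm_lt_top_iff_lintegral_rpow_enorm_lt_top (by simp) (by simp)).1 h.2
  simpa [cost] using this

lemma W2_nonneg {d : ℕ} (μ ν : Measure (E d)) : 0 ≤ W2 μ ν := Real.sqrt_nonneg _

lemma W2_sq_of_mem_optimalPlans {d : ℕ} {μ ν : Measure (E d)} {γ : Measure (E d × E d)}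
    (hγ : γ ∈ optimalPlans μ ν) : W2 μ ν ^ 2 = ∫ p, ‖p.2 - p.1‖ ^ 2 ∂γ := by
  rw [W2, Real.sq_sqrt ENNReal.toReal_nonneg, iInf_cost_eq hγ, toReal_cost]

lemma map_mem_plans {d : ℕ} {Ω : Type*} [MeasurableSpace Ω] (P : Measure Ω)
    {X Z : Ω → E d} (hX : Measurable X) (hZ : Measurable Z) :
    P.map (fun ω => (X ω, Z ω)) ∈ plans (P.map X) (P.map Z) := by
  constructor
  · rw [Measure.map_map measurable_fst (hX.prodMk hZ)]; rfl
  · rw [Measure.map_map measurable_snd (hX.prodMk hZ)]; rfl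

lemma W2_sq_map_le {d : ℕ} {Ω : Type*} [MeasurableSpace Ω] {P : Measure Ω}
    [IsProbabilityMeasure P] {X Z : Ω → E d} (hXm : Measurable X) (hZm : Measurable Z)
    (hX : MemLp X 2 P) (hZ : MemLp Z 2 P) :
    W2 (P.map X) (P.map Z) ^ 2 ≤ ∫ ω, ‖Z ω - X ω‖ ^ 2 ∂P := by
  have hmem := map_mem_plans P hXm hZm
  rw [W2, Real.sq_sqrt ENNReal.toReal_nonneg]
  have hle : ⨅ γ ∈ plans (P.map X) (P.map Z), cost γ ≤ cost (P.map fun ω => (X ω, Z ω)) :=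
    iInf₂_le _ hmem
  refine (ENNReal.toReal_mono
    (cost_lt_top (memP2_map hXm hX) (memP2_map hZm hZ) hmem).ne hle).trans_eq ?_
  rw [toReal_cost, integral_map (hXm.prodMk hZm).aemeasurable (by fun_prop)]

/-! ### The Cauchy–Schwarz inequality -/

section CauchySchwarz

variable {Ω V : Type*} [MeasurableSpace Ω] [NormedAddCommGroup V] {P : Measure Ω} {f g : Ω → V}

lemma integrable_norm_mul_norm (hf : MemLp f 2 P) (hg : MemLp g 2 P) :
    Integrable (fun ω => ‖f ω‖ * ‖g ω‖) P :=
  hf.norm.integrable_mul hg.norm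

lemma integrable_inner [InnerProductSpace ℝ V] (hf : MemLp f 2 P) (hg : MemLp g 2 P) :
    Integrable (fun ω => inner ℝ (f ω) (g ω)) P :=
  (integrable_norm_mul_norm hf hg).mono' (hf.1.inner hg.1)
    (ae_of_all _ fun _ => norm_inner_le_norm _ _)

lemma integrable_norm_sq (hf : MemLp f 2 P) : Integrable (fun ω => ‖f ω‖ ^ 2) P := by
  simpa [sq] using integrable_norm_mul_norm hf hf

lemma integral_norm_mul_norm_le (hf : MemLp f 2 P) (hg : MemLp g 2 P) :
    ∫ ω, ‖f ω‖ * ‖g ω‖ ∂P ≤ √(∫ ω, ‖f ω‖ ^ 2 ∂P) * √(∫ ω, ‖g ω‖ ^ 2 ∂P) := by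
  have h := integral_mul_norm_le_Lp_mul_Lq (μ := P) (f := f) (g := g) (p := 2) (q := 2)
    Real.HolderConjugate.two_two (by simpa using hf) (by simpa using hg)
  simpa [Real.sqrt_eq_rpow] using h

lemma abs_integral_inner_le [InnerProductSpace ℝ V] (hf : MemLp f 2 P) (hg : MemLp g 2 P) :
    |∫ ω, inner ℝ (f ω) (g ω) ∂P| ≤ √(∫ ω, ‖f ω‖ ^ 2 ∂P) * √(∫ ω, ‖g ω‖ ^ 2 ∂P) := by
  refine (abs_integral_le_integral_abs).trans ((integral_mono ?_ ?_ ?_).trans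
    (integral_norm_mul_norm_le hf hg))
  · exact (integrable_inner hf hg).abs
  · exact integrable_norm_mul_norm hf hg
  · intro ω
    exact abs_real_inner_le_norm _ _

end CauchySchwarz

/-! ### Estimates for the potential -/

/-- The gradient of `W`, with the value `0` at the origin. -/
noncomputable def offGradient {d : ℕ} (W : E d → ℝ) (a : E d) : E d :=
  if a = 0 then 0 else gradient W a

@[simp]
lemma offGradient_zero {d : ℕ} (W : E d → ℝ) : offGradient W 0 = 0 := by
  simp [offGradient]

lemma offGradient_of_ne {d : ℕ} (W : E d → ℝ) {a : E d} (ha : a ≠ 0) :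
    offGradient W a = gradient W a := by
  simp [offGradient, ha]

lemma measurable_offGradient {d : ℕ} (W : E d → ℝ) : Measurable (offGradient W) := by
  refine Measurable.ite (measurableSet_singleton 0) measurable_const ?_
  exact (InnerProductSpace.toDual ℝ (E d)).symm.continuous.measurable.comp (measurable_fderiv ℝ W)

/-- The origin is the midpoint of `x` and `-x`. -/
lemma nonneg_of_convex_of_even {d : ℕ} {F : E d → ℝ} (hF : ConvexOn ℝ Set.univ F)
    (heven : ∀ x, F (-x) = F x) (h0 : F 0 = 0) (x : E d) : 0 ≤ F x := by
  have h := hF.2 (Set.mem_univ x) (Set.mem_univ (-x)) (by norm_num : (0 : ℝ) ≤ 1 / 2)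
    (by norm_num : (0 : ℝ) ≤ 1 / 2) (by norm_num)
  rw [heven, smul_neg, add_neg_cancel, h0, smul_eq_mul] at h
  linarith

/-- Prolong the segment from `a` through `b` up to a point `c` at distance `R` from `a`. Convexity
bounds the increment by `‖b - a‖ / R` times `F c`, since `F a` is nonnegative, and growth makes `F
c` of order `R ^ 2`. -/
lemma sub_le_of_convex_of_growth {d : ℕ} {F : E d → ℝ} (hF : ConvexOn ℝ Set.univ F)
    (hpos : ∀ x, 0 ≤ F x) {C : ℝ} (hC : 0 ≤ C) (hgrowth : ∀ z, F z ≤ C * (1 + ‖z‖ ^ 2))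
    (a b : E d) : F b - F a ≤ 5 * C * (1 + ‖a‖ + ‖b‖) * ‖b - a‖ := by
  set R := 1 + ‖a‖ + ‖b‖ with hR
  have ha := norm_nonneg a
  have hb := norm_nonneg b
  rcases eq_or_ne b a with rfl | hne
  · simp
  have hh : 0 < ‖b - a‖ := norm_pos_iff.2 (sub_ne_zero.2 hne)
  have hRpos : 0 < R := by positivity
  have hhR : ‖b - a‖ ≤ R := (norm_sub_le b a).trans (by linarith)
  set s := ‖b - a‖ / R with hs
  have hs0 : 0 < s := by positivity
  have hs1 : s ≤ 1 := (div_le_one hRpos).2 hhR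
  set c := a + s⁻¹ • (b - a) with hc
  have hbc : b = (1 - s) • a + s • c := by
    rw [hc, smul_add, smul_smul, mul_inv_cancel₀ hs0.ne', one_smul, sub_smul, one_smul]
    abel
  have hconv := hF.2 (Set.mem_univ a) (Set.mem_univ c) (sub_nonneg.2 hs1) hs0.le (by ring)
  rw [← hbc, smul_eq_mul, smul_eq_mul] at hconv
  have hcn : ‖c‖ ≤ ‖a‖ + R := by
    refine (norm_add_le _ _).trans ?_
    rw [norm_smul, norm_inv, Real.norm_of_nonneg hs0.le, hs, inv_div, div_mul_cancel₀ _ hh.ne']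
  -- The factor 5 comes from `‖c‖ ≤ 2 * R` and `1 ≤ R`.
  have hFc : F c ≤ C * (5 * R ^ 2) := by
    refine (hgrowth c).trans (mul_le_mul_of_nonneg_left ?_ hC)
    have : ‖c‖ ^ 2 ≤ (2 * R) ^ 2 := by
      apply pow_le_pow_left₀ (norm_nonneg _); linarith
    nlinarith
  have h1 : F b - F a ≤ s * F c := by nlinarith [hpos a]
  refine h1.trans ((mul_le_mul_of_nonneg_left hFc hs0.le).trans_eq ?_)
  rw [hs]
  field_simp

namespace IsAdmissible

variable {d : ℕ} {W : E d → ℝ}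

/-- The growth assumption bounds `W` only from above; evenness and convexity of the corrected
potential `F` supply the lower bound. The estimate is proved for `F` and the explicit corrections
are then subtracted. -/
lemma exists_lipschitz_bound (hW : IsAdmissible W) :
    ∃ K : ℝ, 0 ≤ K ∧ ∀ a b, |W b - W a| ≤ K * (1 + ‖a‖ + ‖b‖) * ‖b - a‖ := by
  obtain ⟨l', l'', hl', hl'', hF⟩ := hW.convex
  obtain ⟨C, hC, hg⟩ := hW.growth
  set F : E d → ℝ := fun x => W x + l'' / 2 * ‖x‖ ^ 2 + l' * ‖x‖ with hFdef
  have hpos : ∀ x, 0 ≤ F x := nonneg_of_convex_of_even hF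
    (fun x => by simp [hFdef, hW.even]) (by simp [hFdef, hW.zero])
  set C' := C + l'' + l' with hC'
  have hgrowth : ∀ z, F z ≤ C' * (1 + ‖z‖ ^ 2) := by
    intro z
    have := hg z
    have h2 : ‖z‖ ≤ 1 + ‖z‖ ^ 2 := by nlinarith [sq_nonneg (‖z‖ - 1)]
    have h3 := mul_le_mul_of_nonneg_left h2 hl'
    have h4 : 0 ≤ l'' * ‖z‖ ^ 2 := by positivity
    simp only [hFdef, hC']
    nlinarith
  have hC'0 : 0 ≤ C' := by positivity
  have hFlip : ∀ a b, |F b - F a| ≤ 5 * C' * (1 + ‖a‖ + ‖b‖) * ‖b - a‖ := by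
    intro a b
    rw [abs_le]
    have h1 := sub_le_of_convex_of_growth hF hpos hC'0 hgrowth a b
    have h2 := sub_le_of_convex_of_growth hF hpos hC'0 hgrowth b a
    rw [norm_sub_rev a b, add_right_comm] at h2
    constructor <;> linarith
  refine ⟨5 * C' + l'' + l', by positivity, fun a b => ?_⟩
  have h1 := hFlip a b
  have h2 : |‖b‖ - ‖a‖| ≤ ‖b - a‖ := abs_norm_sub_norm_le b a
  have ha := norm_nonneg a
  have hb := norm_nonneg b
  have hW' : W b - W a = (F b - F a) - l'' / 2 * ((‖b‖ + ‖a‖) * (‖b‖ - ‖a‖))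
      - l' * (‖b‖ - ‖a‖) := by simp only [hFdef]; ring
  have h3 : |l'' / 2 * ((‖b‖ + ‖a‖) * (‖b‖ - ‖a‖))|
      ≤ l'' * ((1 + ‖a‖ + ‖b‖) * ‖b - a‖) := by
    rw [abs_mul, abs_mul, abs_of_nonneg (by positivity : 0 ≤ l'' / 2),
      abs_of_nonneg (by positivity : 0 ≤ ‖b‖ + ‖a‖)]
    exact mul_le_mul (by linarith) (mul_le_mul (by linarith) h2 (abs_nonneg _) (by positivity))
      (by positivity) hl''
  have h4 : |l' * (‖b‖ - ‖a‖)| ≤ l' * ((1 + ‖a‖ + ‖b‖) * ‖b - a‖) := by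
    rw [abs_mul, abs_of_nonneg hl']
    gcongr
    refine h2.trans (le_mul_of_one_le_left (norm_nonneg _) (by linarith))
  rw [hW']
  calc _ ≤ |F b - F a| + |l'' / 2 * ((‖b‖ + ‖a‖) * (‖b‖ - ‖a‖))| + |l' * (‖b‖ - ‖a‖)| :=
        (abs_sub _ _).trans (add_le_add_left (abs_sub _ _) _)
    _ ≤ _ := by linarith

lemma hasFDerivAt (hW : IsAdmissible W) {a : E d} (ha : a ≠ 0) :
    HasFDerivAt W (fderiv ℝ W a) a :=
  ((hW.contDiffOn.differentiableOn one_ne_zero).differentiableAt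
    (isOpen_compl_singleton.mem_nhds ha)).hasFDerivAt

lemma inner_offGradient {a : E d} (ha : a ≠ 0) (h : E d) :
    inner ℝ (offGradient W a) h = fderiv ℝ W a h := by
  rw [offGradient_of_ne W ha, inner_gradient_left]

lemma tendsto_slope (hW : IsAdmissible W) {a : E d} (ha : a ≠ 0) (h : E d) :
    Tendsto (fun s : ℝ => s⁻¹ * (W (a + s • h) - W a)) (𝓝[>] 0)
      (𝓝 (inner ℝ (offGradient W a) h)) := by
  rw [inner_offGradient ha]
  have := ((hW.hasFDerivAt ha).hasLineDerivAt h).tendsto_slope_zero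
  exact this.mono_left (nhdsWithin_mono _ fun x hx => ne_of_gt hx)

/-- This oddness merges the contributions of the two particles of a pair into one field. -/
lemma offGradient_neg (hW : IsAdmissible W) (a : E d) :
    offGradient W (-a) = -offGradient W a := by
  rcases eq_or_ne a 0 with rfl | ha
  · simp
  have ha' : -a ≠ 0 := neg_ne_zero.2 ha
  refine ext_inner_right ℝ fun h => ?_
  have h1 := hW.tendsto_slope ha' h
  have h2 := hW.tendsto_slope ha (-h)
  have : (fun s : ℝ => s⁻¹ * (W (-a + s • h) - W (-a)))
      = fun s : ℝ => s⁻¹ * (W (a + s • -h) - W a) := by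
    funext s
    rw [hW.even a, ← hW.even (-a + s • h)]
    congr 3
    rw [smul_neg]; abel
  rw [this] at h1
  rw [tendsto_nhds_unique h1 h2, inner_neg_right, inner_neg_left]

lemma norm_offGradient_le (hW : IsAdmissible W) {K : ℝ} (hK0 : 0 ≤ K)
    (hK : ∀ a b, |W b - W a| ≤ K * (1 + ‖a‖ + ‖b‖) * ‖b - a‖) (a : E d) :
    ‖offGradient W a‖ ≤ 2 * K * (1 + ‖a‖) := by
  rcases eq_or_ne a 0 with rfl | ha
  · simpa using hK0
  have hnorm : ‖offGradient W a‖ = ‖fderiv ℝ W a‖ := by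
    rw [offGradient_of_ne W ha, gradient, LinearIsometryEquiv.norm_map]
  rw [hnorm]
  refine (hW.hasFDerivAt ha).le_of_lip' (by positivity) ?_
  filter_upwards [Metric.ball_mem_nhds a one_pos] with b hb
  rw [mem_ball_iff_norm] at hb
  refine (hK a b).trans ?_
  have : ‖b‖ ≤ ‖a‖ + 1 := by
    have := norm_add_le (b - a) a
    rw [sub_add_cancel] at this
    linarith
  have h1 : K * (1 + ‖a‖ + ‖b‖) ≤ 2 * K * (1 + ‖a‖) := by nlinarith
  exact mul_le_mul_of_nonneg_right h1 (norm_nonneg _)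

/-- The quadratic bound is the expansion of `(‖a + h‖ - ‖a‖) ^ 2 ≥ 0`; it deteriorates as `a`
approaches the origin, where the linear bound from the triangle inequality takes over. -/
lemma norm_add_remainder_le {a h : E d} (ha : a ≠ 0) :
    ‖a + h‖ - ‖a‖ - inner ℝ a h / ‖a‖ ≤ min (2 * ‖h‖) (‖h‖ ^ 2 / ‖a‖) := by
  have ha' : 0 < ‖a‖ := norm_pos_iff.2 ha
  have hin := abs_le.1 (abs_real_inner_le_norm a h)
  refine le_min ?_ ?_
  · have h1 : -‖h‖ ≤ inner ℝ a h / ‖a‖ := by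
      rw [le_div_iff₀ ha']; linarith
    have := norm_add_le a h
    linarith
  · have h2 := norm_add_sq_real a h
    rw [le_div_iff₀ ha', sub_mul, sub_mul, div_mul_cancel₀ _ ha'.ne']
    nlinarith [sq_nonneg (‖a + h‖ - ‖a‖), sq_nonneg ‖h‖]

/-- A convex function lies above its tangent at `a`. The slopes of `W` along `h` are bounded through
convexity for `0 < s < 1`, and `s → 0` produces the gradient. -/
lemma subgradient_bound (hW : IsAdmissible W) {l' l'' : ℝ} (hl' : 0 ≤ l') (hl'' : 0 ≤ l'')
    (hF : ConvexOn ℝ Set.univ (fun x => W x + l'' / 2 * ‖x‖ ^ 2 + l' * ‖x‖))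
    {a : E d} (ha : a ≠ 0) (h : E d) :
    -(l'' / 2 * ‖h‖ ^ 2) - l' * min (2 * ‖h‖) (‖h‖ ^ 2 / ‖a‖)
      ≤ W (a + h) - W a - inner ℝ (offGradient W a) h := by
  have ha' : 0 < ‖a‖ := norm_pos_iff.2 ha
  have key : inner ℝ (offGradient W a) h ≤ W (a + h) - W a + l'' / 2 * ‖h‖ ^ 2
      + l' * (‖a + h‖ - ‖a‖ - inner ℝ a h / ‖a‖) := by
    refine le_of_tendsto (hW.tendsto_slope ha h) ?_
    filter_upwards [Ioo_mem_nhdsGT (zero_lt_one' ℝ)] with s hs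
    have hs0 := hs.1
    have hs1 := hs.2
    rw [inv_mul_le_iff₀ hs0]
    have hc := hF.2 (Set.mem_univ a) (Set.mem_univ (a + h)) (sub_nonneg.2 hs1.le) hs0.le (by ring)
    have hpt : (1 - s) • a + s • (a + h) = a + s • h := by
      rw [smul_add, sub_smul, one_smul]; abel
    simp only [hpt, smul_eq_mul] at hc
    -- The tangent inequality for the norm itself, from Cauchy–Schwarz against `a`.
    have h1 : ‖a‖ + s * (inner ℝ a h / ‖a‖) ≤ ‖a + s • h‖ := by
      have := real_inner_le_norm a (a + s • h)
      rw [inner_add_right, real_inner_self_eq_norm_sq, inner_smul_right] at this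
      rw [← mul_le_mul_iff_right₀ ha']
      calc ‖a‖ * (‖a‖ + s * (inner ℝ a h / ‖a‖)) = ‖a‖ ^ 2 + s * inner ℝ a h := by
            field_simp
        _ ≤ _ := this
    have h2 := norm_add_sq_real a (s • h)
    rw [inner_smul_right] at h2
    have h3 := norm_add_sq_real a h
    have h4 := mul_le_mul_of_nonneg_left h1 hl'
    have h5 : l'' / 2 * (‖a‖ ^ 2 + 2 * (s * inner ℝ a h)) ≤ l'' / 2 * ‖a + s • h‖ ^ 2 := by
      refine mul_le_mul_of_nonneg_left ?_ (by positivity)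
      rw [h2]; nlinarith [sq_nonneg ‖s • h‖]
    rw [h3] at hc
    nlinarith
  have := mul_le_mul_of_nonneg_left (norm_add_remainder_le (h := h) ha) hl'
  linarith

/-- Convexity on the segment from the origin to `z`: the term `l' * ‖x‖` is homogeneous of degree
one along it and cancels, so a single value below the parabola forces a negative cusp in direction
`z`. -/
lemma exists_linear_upper_bound {l' l'' : ℝ} (hW : IsAdmissible W) (hl'' : 0 ≤ l'')
    (hF : ConvexOn ℝ Set.univ (fun x => W x + l'' / 2 * ‖x‖ ^ 2 + l' * ‖x‖))
    {z : E d} (hz : W z < -(l'' / 2 * ‖z‖ ^ 2)) :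
    ∃ c : ℝ, 0 < c ∧ ∀ s : ℝ, 0 ≤ s → s ≤ 1 → W (s • z) ≤ -(c * s) := by
  refine ⟨-(l'' / 2 * ‖z‖ ^ 2) - W z, by linarith, fun s hs0 hs1 => ?_⟩
  have hc := hF.2 (Set.mem_univ 0) (Set.mem_univ z) (sub_nonneg.2 hs1) hs0 (by ring)
  simp only [smul_zero, zero_add, norm_zero, hW.zero, smul_eq_mul, norm_smul,
    Real.norm_of_nonneg hs0] at hc
  have : 0 ≤ l'' / 2 * (s * ‖z‖) ^ 2 := by positivity
  nlinarith

lemma abs_le_of_lipschitz_bound (hW : IsAdmissible W) {K : ℝ} (hK0 : 0 ≤ K)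
    (hK : ∀ a b, |W b - W a| ≤ K * (1 + ‖a‖ + ‖b‖) * ‖b - a‖) (z : E d) :
    |W z| ≤ 2 * K * (1 + ‖z‖ ^ 2) := by
  have := hK 0 z
  rw [hW.zero, sub_zero, sub_zero, norm_zero, add_zero] at this
  refine this.trans ?_
  nlinarith [mul_nonneg hK0 (sq_nonneg (‖z‖ - 1)), mul_nonneg hK0 (norm_nonneg z)]

end IsAdmissible

/-! ### The vector field and the expansion of the energy -/

namespace IsAdmissible

variable {d : ℕ} {W : E d → ℝ}

lemma exists_offGradient_bound (hW : IsAdmissible W) :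
    ∃ K : ℝ, 0 ≤ K ∧ ∀ a, ‖offGradient W a‖ ≤ K * (1 + ‖a‖) := by
  obtain ⟨K, hK0, hK⟩ := hW.exists_lipschitz_bound
  exact ⟨2 * K, by positivity, hW.norm_offGradient_le hK0 hK⟩

lemma memLp_offGradient_comp {Ω : Type*} [MeasurableSpace Ω] {P : Measure Ω} [IsFiniteMeasure P]
    (hW : IsAdmissible W) {A : Ω → E d} (hA : MemLp A 2 P) :
    MemLp (fun ω => offGradient W (A ω)) 2 P := by
  obtain ⟨K, hK0, hK⟩ := hW.exists_offGradient_bound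
  have h : MemLp (fun ω => K * (1 + ‖A ω‖)) 2 P :=
    ((memLp_const (1 : ℝ)).add hA.norm).const_mul K
  refine h.mono ((measurable_offGradient W).comp_aemeasurable
    hA.1.aemeasurable).aestronglyMeasurable (ae_of_all _ fun ω => ?_)
  exact (hK _).trans (le_abs_self _)

lemma integrable_comp {Ω : Type*} [MeasurableSpace Ω] {P : Measure Ω} [IsFiniteMeasure P]
    (hW : IsAdmissible W) {A : Ω → E d} (hA : MemLp A 2 P) :
    Integrable (fun ω => W (A ω)) P := by
  obtain ⟨K, hK0, hK⟩ := hW.exists_lipschitz_bound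
  have h : Integrable (fun ω => 2 * K * (1 + ‖A ω‖ ^ 2)) P :=
    ((integrable_const (1 : ℝ)).add (integrable_norm_sq hA)).const_mul _
  exact h.mono' (hW.continuous.comp_aestronglyMeasurable hA.1)
    (ae_of_all _ fun ω => hW.abs_le_of_lipschitz_bound hK0 hK _)

lemma integrable_offGradient_sub (hW : IsAdmissible W) {μ : Measure (E d)} (hμ : MemP2 μ)
    (x : E d) : Integrable (fun y => offGradient W (x - y)) μ := by
  have := hμ.isProbabilityMeasure
  exact (hW.memLp_offGradient_comp ((memLp_const x).sub hμ.memLp_id)).integrable (by norm_num)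

end IsAdmissible

variable {d : ℕ} {W : E d → ℝ}

lemma indicator_gradient_sub (W : E d → ℝ) (x : E d) :
    Set.indicator {x}ᶜ (fun y => gradient W (x - y)) = fun y => offGradient W (x - y) := by
  funext y
  by_cases h : y = x
  · simp [h]
  · have : x - y ≠ 0 := sub_ne_zero.2 (Ne.symm h)
    rw [offGradient_of_ne W this, Set.indicator_of_mem (by simpa using h)]

lemma integrableOn_gradient_sub (hW : IsAdmissible W) {μ : Measure (E d)} (hμ : MemP2 μ)
    (x : E d) : IntegrableOn (fun y => gradient W (x - y)) {x}ᶜ μ := by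
  rw [← integrable_indicator_iff (measurableSet_singleton x).compl, indicator_gradient_sub]
  exact hW.integrable_offGradient_sub hμ x

lemma field_eq (W : E d → ℝ) (μ : Measure (E d)) (x : E d) :
    field W μ x = ∫ y, offGradient W (x - y) ∂μ := by
  rw [field, ← integral_indicator (measurableSet_singleton x).compl, indicator_gradient_sub]

lemma measurable_field (W : E d → ℝ) (μ : Measure (E d)) [SFinite μ] :
    Measurable (field W μ) := by
  have h : StronglyMeasurable (Function.uncurry fun x y : E d => offGradient W (x - y)) :=
    ((measurable_offGradient W).comp (measurable_fst.sub measurable_snd)).stronglyMeasurable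
  have := h.integral_prod_right (ν := μ)
  simp_rw [← field_eq] at this
  exact this.measurable

lemma memLp_field (hW : IsAdmissible W) {μ : Measure (E d)} (hμ : MemP2 μ) :
    MemLp (field W μ) 2 μ := by
  have := hμ.isProbabilityMeasure
  obtain ⟨K, hK0, hK⟩ := hW.exists_offGradient_bound
  have hint : Integrable (fun y : E d => ‖y‖) μ := (hμ.memLp_id.integrable (by norm_num)).norm
  set M := ∫ y, ‖y‖ ∂μ
  have h : MemLp (fun x : E d => K * (1 + M + ‖x‖)) 2 μ :=
    ((memLp_const (1 + M : ℝ)).add hμ.memLp_id.norm).const_mul K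
  refine h.mono (measurable_field W μ).aestronglyMeasurable (ae_of_all _ fun x => ?_)
  refine le_trans ?_ (le_abs_self _)
  rw [field_eq]
  calc ‖∫ y, offGradient W (x - y) ∂μ‖ ≤ ∫ y, K * (1 + ‖x‖ + ‖y‖) ∂μ := by
        refine norm_integral_le_of_norm_le
          (((integrable_const (1 + ‖x‖ : ℝ)).add hint).const_mul K) (ae_of_all _ fun y => ?_)
        refine (hK _).trans (mul_le_mul_of_nonneg_left ?_ hK0)
        have := norm_sub_le x y
        linarith
    _ = K * (1 + M + ‖x‖) := by
        rw [integral_const_mul, integral_add (integrable_const _) hint]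
        simp [M]; ring_nf; simp

/-- The first order Taylor remainder of `W` at `a`. -/
noncomputable def remainder (W : E d → ℝ) (a h : E d) : ℝ :=
  W (a + h) - W a - inner ℝ (offGradient W a) h

lemma remainder_zero (hW : IsAdmissible W) (h : E d) : remainder W 0 h = W h := by
  simp [remainder, hW.zero]

section Expansion

variable {Ω : Type*} [MeasurableSpace Ω] {P : Measure Ω} [IsProbabilityMeasure P]

lemma memLp_prod_sub {X : Ω → E d} (hX : MemLp X 2 P) :
    MemLp (fun q : Ω × Ω => X q.1 - X q.2) 2 (P.prod P) :=
  (hX.comp_fst P).sub (hX.comp_snd P)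

lemma energy_map (W : E d → ℝ) (hW : IsAdmissible W) {X : Ω → E d} (hXm : Measurable X) :
    energy W (P.map X) = 1 / 2 * ∫ q, W (X q.1 - X q.2) ∂(P.prod P) := by
  have hc := hW.continuous
  rw [energy, Measure.map_prod_map _ _ hXm hXm, integral_map (hXm.prodMap hXm).aemeasurable]
  · rfl
  · exact (hc.comp (continuous_fst.sub continuous_snd)).aestronglyMeasurable

lemma integrable_remainder (hW : IsAdmissible W) {X H : Ω → E d} (hX : MemLp X 2 P)
    (hH : MemLp H 2 P) :
    Integrable (fun q : Ω × Ω => remainder W (X q.1 - X q.2) (H q.1 - H q.2)) (P.prod P) := by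
  have hA := memLp_prod_sub hX
  have hD := memLp_prod_sub hH
  exact ((hW.integrable_comp (hA.add hD)).sub (hW.integrable_comp hA)).sub
    (integrable_inner (hW.memLp_offGradient_comp hA) hD)

/-- Exchanging the two copies and using oddness of the gradient turns the `H q.2` term into minus
the `H q.1` term; integrating out the second copy yields the field. -/
lemma integral_inner_offGradient (hW : IsAdmissible W) {X H : Ω → E d} (hXm : Measurable X)
    (hX : MemLp X 2 P) (hH : MemLp H 2 P) :
    ∫ q, inner ℝ (offGradient W (X q.1 - X q.2)) (H q.1 - H q.2) ∂(P.prod P)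
      = 2 * ∫ ω, inner ℝ (field W (P.map X) (X ω)) (H ω) ∂P := by
  have hG := hW.memLp_offGradient_comp (memLp_prod_sub hX)
  have h1 := integrable_inner hG (hH.comp_fst P)
  have h2 := integrable_inner hG (hH.comp_snd P)
  have hfst : ∫ q, inner ℝ (offGradient W (X q.1 - X q.2)) (H q.1) ∂(P.prod P)
      = ∫ ω, inner ℝ (field W (P.map X) (X ω)) (H ω) ∂P := by
    rw [integral_prod _ h1]
    refine integral_congr_ae (ae_of_all _ fun ω => ?_)
    have hint : Integrable (fun ω' => offGradient W (X ω - X ω')) P :=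
      (hW.memLp_offGradient_comp ((memLp_const (X ω)).sub hX)).integrable (by norm_num)
    have hfield : field W (P.map X) (X ω) = ∫ ω', offGradient W (X ω - X ω') ∂P := by
      rw [field_eq, integral_map hXm.aemeasurable]
      exact ((measurable_offGradient W).comp (by fun_prop)).aestronglyMeasurable
    simp only [hfield]
    rw [real_inner_comm, ← integral_inner hint]
    exact integral_congr_ae (ae_of_all _ fun ω' => real_inner_comm _ _)
  have hsnd : ∫ q, inner ℝ (offGradient W (X q.1 - X q.2)) (H q.2) ∂(P.prod P)
      = -∫ q, inner ℝ (offGradient W (X q.1 - X q.2)) (H q.1) ∂(P.prod P) := by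
    rw [← integral_prod_swap, ← integral_neg]
    refine integral_congr_ae (ae_of_all _ fun q => ?_)
    simp only [Prod.fst_swap, Prod.snd_swap]
    rw [← neg_sub (X q.1) (X q.2), hW.offGradient_neg, inner_neg_left]
  simp_rw [inner_sub_right]
  rw [integral_sub h1 h2, hsnd, hfst]
  ring

/-- First order expansion of the interaction energy under a perturbation `X + H` of `X`. -/
theorem energy_map_add_sub (hW : IsAdmissible W) {X H : Ω → E d} (hXm : Measurable X)
    (hHm : Measurable H) (hX : MemLp X 2 P) (hH : MemLp H 2 P) :
    energy W (P.map fun ω => X ω + H ω) - energy W (P.map X)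
      = ∫ ω, inner ℝ (field W (P.map X) (X ω)) (H ω) ∂P
        + 1 / 2 * ∫ q, remainder W (X q.1 - X q.2) (H q.1 - H q.2) ∂(P.prod P) := by
  have hA := memLp_prod_sub hX
  have hD := memLp_prod_sub hH
  have hi1 : Integrable (fun q : Ω × Ω => W (X q.1 - X q.2 + (H q.1 - H q.2))) (P.prod P) :=
    hW.integrable_comp (hA.add hD)
  have hi2 := hW.integrable_comp hA
  have hi12 : Integrable (fun q : Ω × Ω => W (X q.1 - X q.2 + (H q.1 - H q.2))
    - W (X q.1 - X q.2)) (P.prod P) := hi1.sub hi2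
  have hi3 := integrable_inner (hW.memLp_offGradient_comp hA) hD
  rw [energy_map W hW (X := fun ω => X ω + H ω) (by fun_prop), energy_map W hW hXm]
  have hsplit : ∫ q, remainder W (X q.1 - X q.2) (H q.1 - H q.2) ∂(P.prod P)
      = ∫ q, W (X q.1 + H q.1 - (X q.2 + H q.2)) ∂(P.prod P)
        - ∫ q, W (X q.1 - X q.2) ∂(P.prod P)
        - 2 * ∫ ω, inner ℝ (field W (P.map X) (X ω)) (H ω) ∂P := by
    simp only [remainder]
    rw [integral_sub hi12 hi3, integral_sub hi1 hi2,
      integral_inner_offGradient hW hXm hX hH]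
    simp_rw [add_sub_add_comm]
  rw [hsplit]
  ring

lemma integral_norm_sub_sq_le {H : Ω → E d} (hH : MemLp H 2 P) :
    ∫ q, ‖H q.1 - H q.2‖ ^ 2 ∂(P.prod P) ≤ 4 * ∫ ω, ‖H ω‖ ^ 2 ∂P := by
  have h1 := integrable_norm_sq (hH.comp_fst P)
  have h2 := integrable_norm_sq (hH.comp_snd P)
  calc ∫ q, ‖H q.1 - H q.2‖ ^ 2 ∂(P.prod P)
      ≤ ∫ q, (2 * ‖H q.1‖ ^ 2 + 2 * ‖H q.2‖ ^ 2) ∂(P.prod P) := by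
        refine integral_mono (integrable_norm_sq (memLp_prod_sub hH))
          ((h1.const_mul 2).add (h2.const_mul 2)) fun q => ?_
        have := parallelogram_law_with_norm ℝ (H q.1) (H q.2)
        simp only
        nlinarith [mul_self_nonneg ‖H q.1 + H q.2‖]
    _ = 4 * ∫ ω, ‖H ω‖ ^ 2 ∂P := by
        rw [integral_add (h1.const_mul 2) (h2.const_mul 2), integral_const_mul,
          integral_const_mul, integral_fun_fst (fun ω => ‖H ω‖ ^ 2),
          integral_fun_snd (fun ω => ‖H ω‖ ^ 2)]
        simp; ring

end Expansion

/-! ### Directional derivatives of the energy -/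

lemma abs_remainder_smul_le (hW : IsAdmissible W) {K : ℝ} (hK0 : 0 ≤ K)
    (hK : ∀ a b, |W b - W a| ≤ K * (1 + ‖a‖ + ‖b‖) * ‖b - a‖) (a h : E d) {t : ℝ}
    (ht0 : 0 ≤ t) (ht1 : t ≤ 1) :
    |remainder W a (t • h)| ≤ t * (K * ((3 + 4 * ‖a‖ + ‖h‖) * ‖h‖)) := by
  have hn : ‖t • h‖ = t * ‖h‖ := by rw [norm_smul, Real.norm_of_nonneg ht0]
  have h1 := hK a (a + t • h)
  rw [add_sub_cancel_left, hn] at h1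
  have h2 : ‖a + t • h‖ ≤ ‖a‖ + ‖h‖ := by
    refine (norm_add_le _ _).trans ?_
    rw [hn]
    nlinarith [norm_nonneg h]
  have h3 : |inner ℝ (offGradient W a) (t • h)| ≤ 2 * K * (1 + ‖a‖) * (t * ‖h‖) := by
    refine (abs_real_inner_le_norm _ _).trans ?_
    rw [hn]
    exact mul_le_mul_of_nonneg_right (hW.norm_offGradient_le hK0 hK a) (by positivity)
  have h4 : K * (1 + ‖a‖ + ‖a + t • h‖) * (t * ‖h‖)
      ≤ K * (1 + ‖a‖ + (‖a‖ + ‖h‖)) * (t * ‖h‖) := by gcongr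
  calc |remainder W a (t • h)|
      ≤ |W (a + t • h) - W a| + |inner ℝ (offGradient W a) (t • h)| := abs_sub _ _
    _ ≤ _ := by nlinarith

lemma tendsto_remainder_smul (hW : IsAdmissible W) {a : E d} (ha : a ≠ 0) (h : E d) :
    Tendsto (fun t : ℝ => t⁻¹ * remainder W a (t • h)) (𝓝[>] 0) (𝓝 0) := by
  have h1 := (hW.tendsto_slope ha h).sub_const (inner ℝ (offGradient W a) h)
  rw [sub_self] at h1
  refine h1.congr' ?_
  filter_upwards [self_mem_nhdsWithin] with t ht
  have ht' : t ≠ 0 := ne_of_gt ht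
  rw [remainder, inner_smul_right]
  field_simp

section Variation

variable {Ω : Type*} [MeasurableSpace Ω] {P : Measure Ω} [IsProbabilityMeasure P]
  {X H : Ω → E d}

/-- Dominated convergence, with the majorant from `abs_remainder_smul_le`. The diagonal is removed
because `W` need not be differentiable at the origin. -/
lemma tendsto_integral_remainder_offDiagonal (hW : IsAdmissible W) (hXm : Measurable X)
    (hHm : Measurable H) (hX : MemLp X 2 P) (hH : MemLp H 2 P) :
    Tendsto (fun t : ℝ => ∫ q, t⁻¹ * Set.indicator {q : Ω × Ω | X q.1 = X q.2}ᶜ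
      (fun q => remainder W (X q.1 - X q.2) (t • (H q.1 - H q.2))) q ∂(P.prod P))
      (𝓝[>] 0) (𝓝 0) := by
  obtain ⟨K, hK0, hK⟩ := hW.exists_lipschitz_bound
  have hS : MeasurableSet {q : Ω × Ω | X q.1 = X q.2} :=
    measurableSet_eq_fun (by fun_prop) (by fun_prop)
  have hA := memLp_prod_sub hX
  have hD := memLp_prod_sub hH
  have hbound : Integrable (fun q : Ω × Ω => K * ((3 + 4 * ‖X q.1 - X q.2‖ + ‖H q.1 - H q.2‖)
      * ‖H q.1 - H q.2‖)) (P.prod P) :=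
    ((((memLp_const (3 : ℝ)).add (hA.norm.const_mul 4)).add hD.norm).integrable_mul
      hD.norm).const_mul K
  have h0 : 𝓝 (0 : ℝ) = 𝓝 (∫ _ : Ω × Ω, (0 : ℝ) ∂(P.prod P)) := by simp
  rw [h0]
  refine tendsto_integral_filter_of_dominated_convergence _ ?_ ?_ hbound ?_
  · refine Eventually.of_forall fun t => ?_
    refine (Measurable.aestronglyMeasurable ?_)
    refine measurable_const.mul (Measurable.indicator ?_ hS.compl)
    have hc := hW.continuous.measurable
    have hg := measurable_offGradient W
    unfold remainder
    fun_prop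
  · filter_upwards [Ioo_mem_nhdsGT (zero_lt_one' ℝ)] with t ht
    refine ae_of_all _ fun q => ?_
    rw [norm_mul, norm_inv, Real.norm_of_nonneg ht.1.le, inv_mul_le_iff₀ ht.1]
    refine (norm_indicator_le_norm_self _ _).trans ?_
    exact abs_remainder_smul_le hW hK0 hK _ _ ht.1.le ht.2.le
  · refine ae_of_all _ fun q => ?_
    by_cases hq : X q.1 = X q.2
    · have : q ∉ {q : Ω × Ω | X q.1 = X q.2}ᶜ := by simpa using hq
      simp only [Set.indicator_of_notMem this, mul_zero]
      exact tendsto_const_nhds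
    · have : q ∈ {q : Ω × Ω | X q.1 = X q.2}ᶜ := by simpa using hq
      simp only [Set.indicator_of_mem this]
      exact tendsto_remainder_smul hW (sub_ne_zero.2 hq) _

/-- Upper bound for the energy along the perturbation `X + t H`; only pairs with `X ω = X ω'`
contribute beyond the linear term. -/
theorem eventually_energy_le (hW : IsAdmissible W) (hXm : Measurable X)
    (hHm : Measurable H) (hX : MemLp X 2 P) (hH : MemLp H 2 P) {ε : ℝ} (hε : 0 < ε) :
    ∀ᶠ t : ℝ in 𝓝[>] 0,
      energy W (P.map fun ω => X ω + t • H ω) - energy W (P.map X)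
        ≤ t * ∫ ω, inner ℝ (field W (P.map X) (X ω)) (H ω) ∂P
          + 1 / 2 * ∫ q, Set.indicator {q : Ω × Ω | X q.1 = X q.2}
            (fun q => W (t • (H q.1 - H q.2))) q ∂(P.prod P) + ε * t := by
  have hlim := tendsto_integral_remainder_offDiagonal hW hXm hHm hX hH
  filter_upwards [hlim.eventually (gt_mem_nhds hε), self_mem_nhdsWithin] with t ht ht0
  replace ht0 : 0 < t := ht0
  have hS : MeasurableSet {q : Ω × Ω | X q.1 = X q.2} :=
    measurableSet_eq_fun (by fun_prop) (by fun_prop)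
  have hHt : MemLp (fun ω => t • H ω) 2 P := hH.const_smul t
  have hint := integrable_remainder hW hX hHt
  rw [energy_map_add_sub (H := fun ω => t • H ω) hW hXm (by fun_prop) hX hHt]
  have hdiag : ∫ q, Set.indicator {q : Ω × Ω | X q.1 = X q.2}
      (fun q => W (t • (H q.1 - H q.2))) q ∂(P.prod P)
      = ∫ q in {q : Ω × Ω | X q.1 = X q.2},
        remainder W (X q.1 - X q.2) (t • H q.1 - t • H q.2) ∂(P.prod P) := by
    rw [integral_indicator hS]
    refine setIntegral_congr_fun hS fun q hq => ?_
    have hq' : X q.1 = X q.2 := hq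
    simp only [hq', sub_self, remainder_zero hW, smul_sub]
  have hoff : ∫ q in {q : Ω × Ω | X q.1 = X q.2}ᶜ,
      remainder W (X q.1 - X q.2) (t • H q.1 - t • H q.2) ∂(P.prod P) ≤ ε * t := by
    rw [integral_const_mul, integral_indicator hS.compl, inv_mul_lt_iff₀ ht0] at ht
    simp_rw [← smul_sub]
    linarith
  rw [← integral_add_compl hS hint, hdiag]
  simp_rw [inner_smul_right]
  rw [integral_const_mul]
  have : 0 ≤ ε * t := by positivity
  linarith

end Variation

/-- The sets shrink to the empty set because `f ω = 0` is excluded. This serves both for pairs close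
to the diagonal and for punctured balls around an atom. -/
lemma tendsto_measureReal_pos_le {Ω : Type*} [MeasurableSpace Ω] {P : Measure Ω}
    [IsFiniteMeasure P] {f : Ω → ℝ} (hf : Measurable f) :
    Tendsto (fun η : ℝ => P.real {ω | 0 < f ω ∧ f ω ≤ η}) (𝓝[>] 0) (𝓝 0) := by
  have hS : ∀ η : ℝ, MeasurableSet {ω | 0 < f ω ∧ f ω ≤ η} := fun η =>
    (measurableSet_lt measurable_const hf).inter (measurableSet_le hf measurable_const)
  have hrw : ∀ η : ℝ, P.real {ω | 0 < f ω ∧ f ω ≤ η}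
      = ∫ ω, Set.indicator {ω | 0 < f ω ∧ f ω ≤ η} (fun _ => (1 : ℝ)) ω ∂P := by
    intro η
    rw [integral_indicator_const _ (hS η), smul_eq_mul, mul_one]
  simp_rw [hrw]
  have h0 : 𝓝 (0 : ℝ) = 𝓝 (∫ _ : Ω, (0 : ℝ) ∂P) := by simp
  rw [h0]
  refine tendsto_integral_filter_of_dominated_convergence (fun _ => (1 : ℝ)) ?_ ?_
    (integrable_const _) ?_
  · exact Eventually.of_forall fun η =>
      (measurable_const.indicator (hS η)).aestronglyMeasurable
  · refine Eventually.of_forall fun η => ae_of_all _ fun ω => ?_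
    refine (norm_indicator_le_norm_self _ _).trans (by simp)
  · refine ae_of_all _ fun ω => ?_
    refine tendsto_const_nhds.congr' ?_
    by_cases h : 0 < f ω
    · filter_upwards [Ioo_mem_nhdsGT h] with η hη
      rw [Set.indicator_of_notMem]
      intro hmem
      exact absurd hmem.2 (not_le.2 hη.2)
    · exact Eventually.of_forall fun η =>
        (Set.indicator_of_notMem (fun hmem => h hmem.1) _).symm

/-! ### The vector field belongs to the subdifferential -/

lemma ae_prod_fst_ne {μ : Measure (E d)} [IsProbabilityMeasure μ] (hμ0 : ∀ x, μ {x} = 0)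
    {γ : Measure (E d × E d)} [IsProbabilityMeasure γ] (hγ : γ.map Prod.fst = μ) :
    ∀ᵐ q ∂(γ.prod γ), q.1.1 - q.2.1 ≠ 0 := by
  have hdiag : ∀ᵐ q ∂(μ.prod μ), q.1 ≠ q.2 := by
    have hm : MeasurableSet {q : E d × E d | q.1 ≠ q.2} :=
      (measurableSet_eq_fun measurable_fst measurable_snd).compl
    refine (Measure.ae_prod_iff_ae_ae hm).2 (ae_of_all _ fun x => ?_)
    have : {y : E d | ¬ x ≠ y} = {x} := by ext y; simp [eq_comm]
    rw [ae_iff, this]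
    exact hμ0 x
  have hmap : (γ.prod γ).map (Prod.map Prod.fst Prod.fst) = μ.prod μ := by
    rw [← Measure.map_prod_map _ _ measurable_fst measurable_fst, hγ]
  rw [← hmap] at hdiag
  filter_upwards [ae_of_ae_map (by fun_prop) hdiag] with q hq
  exact sub_ne_zero.2 hq

/-- The minimum in `subgradient_bound` is resolved at the threshold `η`: quadratic beyond it, linear
on the punctured ball inside it. -/
lemma remainder_ge (hW : IsAdmissible W) {l' l'' : ℝ} (hl' : 0 ≤ l') (hl'' : 0 ≤ l'')
    (hF : ConvexOn ℝ Set.univ (fun x => W x + l'' / 2 * ‖x‖ ^ 2 + l' * ‖x‖))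
    {η : ℝ} (hη : 0 < η) {a : E d} (h : E d)
    (ha : a ≠ 0 ∨ ∀ z, -(l'' / 2 * ‖z‖ ^ 2) ≤ W z) :
    -(l'' / 2 * ‖h‖ ^ 2) - l' * (‖h‖ ^ 2 / η
      + 2 * (‖h‖ * Set.indicator {a : E d | 0 < ‖a‖ ∧ ‖a‖ ≤ η} (fun _ => (1 : ℝ)) a))
      ≤ remainder W a h := by
  have hind : 0 ≤ Set.indicator {a : E d | 0 < ‖a‖ ∧ ‖a‖ ≤ η} (fun _ => (1 : ℝ)) a :=
    Set.indicator_nonneg (fun _ _ => zero_le_one) _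
  rcases eq_or_ne a 0 with rfl | ha0
  · have hz := (ha.resolve_left (by simp)) h
    rw [remainder_zero hW]
    have : 0 ≤ l' * (‖h‖ ^ 2 / η + 2 * (‖h‖ *
      Set.indicator {a : E d | 0 < ‖a‖ ∧ ‖a‖ ≤ η} (fun _ => (1 : ℝ)) (0 : E d))) := by
      positivity
    linarith
  · refine le_trans ?_ (hW.subgradient_bound hl' hl'' hF ha0 h)
    have hmin : min (2 * ‖h‖) (‖h‖ ^ 2 / ‖a‖) ≤ ‖h‖ ^ 2 / η + 2 * (‖h‖ *
        Set.indicator {a : E d | 0 < ‖a‖ ∧ ‖a‖ ≤ η} (fun _ => (1 : ℝ)) a) := by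
      by_cases hle : ‖a‖ ≤ η
      · rw [Set.indicator_of_mem (show a ∈ {a : E d | 0 < ‖a‖ ∧ ‖a‖ ≤ η} from
          ⟨norm_pos_iff.2 ha0, hle⟩)]
        refine (min_le_left _ _).trans ?_
        have : 0 ≤ ‖h‖ ^ 2 / η := by positivity
        linarith
      · refine (min_le_right _ _).trans ?_
        have h1 : ‖h‖ ^ 2 / ‖a‖ ≤ ‖h‖ ^ 2 / η :=
          div_le_div_of_nonneg_left (by positivity) hη (not_le.1 hle).le
        have : 0 ≤ 2 * (‖h‖ *
          Set.indicator {a : E d | 0 < ‖a‖ ∧ ‖a‖ ≤ η} (fun _ => (1 : ℝ)) a) := by positivity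
        linarith
    have := mul_le_mul_of_nonneg_left hmin hl'
    linarith

/-- Cauchy–Schwarz on the near-diagonal indicator turns the linear part of the error into `w * τ`,
which is as small a multiple of `w` as desired. In the application `w` is the Wasserstein distance.
-/
lemma integral_remainder_ge {Ω : Type*} [MeasurableSpace Ω] {P : Measure Ω}
    [IsProbabilityMeasure P] (hW : IsAdmissible W) {l' l'' : ℝ} (hl' : 0 ≤ l') (hl'' : 0 ≤ l'')
    (hF : ConvexOn ℝ Set.univ (fun x => W x + l'' / 2 * ‖x‖ ^ 2 + l' * ‖x‖))
    {X H : Ω → E d} (hXm : Measurable X) (hX : MemLp X 2 P) (hH : MemLp H 2 P)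
    (hdiag : (∀ᵐ q ∂(P.prod P), X q.1 - X q.2 ≠ 0) ∨ ∀ z, -(l'' / 2 * ‖z‖ ^ 2) ≤ W z)
    {η τ w : ℝ} (hη : 0 < η) (hτ : 0 ≤ τ) (hw : 0 ≤ w)
    (hN : (P.prod P).real {q | 0 < ‖X q.1 - X q.2‖ ∧ ‖X q.1 - X q.2‖ ≤ η} ≤ τ ^ 2)
    (hHw : ∫ ω, ‖H ω‖ ^ 2 ∂P ≤ w ^ 2) :
    -2 * w * ((l'' + 2 * l' / η) * w + 2 * l' * τ)
      ≤ ∫ q, remainder W (X q.1 - X q.2) (H q.1 - H q.2) ∂(P.prod P) := by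
  set S : Set (E d) := {a : E d | 0 < ‖a‖ ∧ ‖a‖ ≤ η} with hSdef
  have hSm : MeasurableSet S := (measurableSet_lt measurable_const measurable_norm).inter
    (measurableSet_le measurable_norm measurable_const)
  have hint := integrable_remainder hW hX hH
  have hDL := memLp_prod_sub hH
  have hD2 : ∫ q, ‖H q.1 - H q.2‖ ^ 2 ∂(P.prod P) ≤ 4 * w ^ 2 :=
    (integral_norm_sub_sq_le hH).trans (by linarith)
  have hAm : Measurable fun q : Ω × Ω => X q.1 - X q.2 := by fun_prop
  generalize hA : (fun q : Ω × Ω => X q.1 - X q.2) = A at hAm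
  generalize hD : (fun q : Ω × Ω => H q.1 - H q.2) = D at hDL
  have hA' : ∀ q : Ω × Ω, X q.1 - X q.2 = A q := fun q => congrFun hA q
  have hD' : ∀ q : Ω × Ω, H q.1 - H q.2 = D q := fun q => congrFun hD q
  simp only [hA', hD'] at hint hD2 hN hdiag ⊢
  set χ : Ω × Ω → ℝ := (A ⁻¹' S).indicator (fun _ => (1 : ℝ)) with hχ
  have hχ0 : ∀ q, 0 ≤ χ q := fun q => Set.indicator_nonneg (fun _ _ => zero_le_one) _
  have hχL : MemLp χ 2 (P.prod P) := (memLp_const (1 : ℝ)).indicator (hAm hSm)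
  have hχ2 : ∫ q, ‖χ q‖ ^ 2 ∂(P.prod P) ≤ τ ^ 2 := by
    have h1 : ∀ q, ‖χ q‖ ^ 2 = χ q := by
      intro q
      by_cases hq : q ∈ A ⁻¹' S <;> simp [χ, hq]
    simp_rw [h1, χ]
    rw [integral_indicator_const _ (hAm hSm), smul_eq_mul, mul_one]
    exact hN
  have hcs : ∫ q, ‖D q‖ * χ q ∂(P.prod P) ≤ 2 * w * τ := by
    have h := integral_norm_mul_norm_le hDL.norm hχL
    have h1 : ∀ q, ‖‖D q‖‖ * ‖χ q‖ = ‖D q‖ * χ q := by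
      intro q
      rw [norm_norm, Real.norm_of_nonneg (hχ0 q)]
    simp_rw [h1, norm_norm] at h
    refine h.trans (mul_le_mul ?_ ?_ (Real.sqrt_nonneg _) (by positivity))
    · rw [Real.sqrt_le_left (by positivity)]
      linarith
    · rw [Real.sqrt_le_left hτ]
      exact hχ2
  have hae : ∀ᵐ q ∂(P.prod P), -(l'' / 2 * ‖D q‖ ^ 2) - l' * (‖D q‖ ^ 2 / η
      + 2 * (‖D q‖ * χ q)) ≤ remainder W (A q) (D q) := by
    rcases hdiag with h | h
    · filter_upwards [h] with q hq
      exact remainder_ge hW hl' hl'' hF hη _ (Or.inl hq)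
    · exact ae_of_all _ fun q => remainder_ge hW hl' hl'' hF hη _ (Or.inr h)
  have hDi := integrable_norm_sq hDL
  have hDχ : Integrable (fun q => ‖D q‖ * χ q) (P.prod P) := hDL.norm.integrable_mul hχL
  have hi1 : Integrable (fun q => -(l'' / 2 * ‖D q‖ ^ 2)) (P.prod P) := (hDi.const_mul _).neg
  have hi2 : Integrable (fun q => ‖D q‖ ^ 2 / η + 2 * (‖D q‖ * χ q)) (P.prod P) :=
    (hDi.div_const η).add (hDχ.const_mul 2)
  have hmono := integral_mono_ae (hi1.sub (hi2.const_mul l')) hint hae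
  have hcalc : ∫ q, (-(l'' / 2 * ‖D q‖ ^ 2) - l' * (‖D q‖ ^ 2 / η + 2 * (‖D q‖ * χ q)))
      ∂(P.prod P) = -(l'' / 2 * ∫ q, ‖D q‖ ^ 2 ∂(P.prod P))
        - l' * ((∫ q, ‖D q‖ ^ 2 ∂(P.prod P)) / η + 2 * ∫ q, ‖D q‖ * χ q ∂(P.prod P)) := by
    rw [integral_sub hi1 (hi2.const_mul l'), integral_neg, integral_const_mul,
      integral_const_mul, integral_add (hDi.div_const η) (hDχ.const_mul 2), integral_div,
      integral_const_mul]
  refine le_trans (le_trans ?_ hcalc.symm.le) hmono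
  calc -2 * w * ((l'' + 2 * l' / η) * w + 2 * l' * τ)
      = -(l'' / 2 * (4 * w ^ 2)) - l' * ((4 * w ^ 2) / η + 2 * (2 * w * τ)) := by
        field_simp
        ring
    _ ≤ _ := by gcongr

/-- The subgradient inequality for `field W μ` along every optimal plan. -/
theorem energy_sub_ge_of_optimalPlan (hW : IsAdmissible W) {μ : Measure (E d)} (hμ : MemP2 μ)
    {l' l'' : ℝ} (hl' : 0 ≤ l') (hl'' : 0 ≤ l'')
    (hF : ConvexOn ℝ Set.univ (fun x => W x + l'' / 2 * ‖x‖ ^ 2 + l' * ‖x‖))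
    (hdiag : (∀ x, μ {x} = 0) ∨ ∀ z, -(l'' / 2 * ‖z‖ ^ 2) ≤ W z) {ε : ℝ} (hε : 0 < ε) :
    ∃ δ : ℝ, 0 < δ ∧ ∀ ν : Measure (E d), MemP2 ν → W2 μ ν < δ → ∀ γ ∈ optimalPlans μ ν,
      ∫ p, inner ℝ (field W μ p.1) (p.2 - p.1) ∂γ - ε * W2 μ ν ≤ energy W ν - energy W μ := by
  have hμp := hμ.isProbabilityMeasure
  have hlim := tendsto_measureReal_pos_le (P := μ.prod μ)
    (f := fun q : E d × E d => ‖q.1 - q.2‖) (by fun_prop)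
  -- Order of choices: `τ` makes `2 * l' * τ ≤ ε / 2`, then `η` depends on `τ`, and the radius
  -- depends on `η` so that the quadratic part also costs at most `ε / 2`.
  set τ := ε / (4 * (l' + 1)) with hτ
  have hτ0 : 0 < τ := by positivity
  obtain ⟨η, hη0, hηN⟩ := ((eventually_mem_nhdsWithin).and
    (hlim.eventually (gt_mem_nhds (pow_pos hτ0 2)))).exists
  replace hη0 : 0 < η := hη0
  refine ⟨ε / (2 * (l'' + 2 * l' / η + 1)), by positivity, fun ν hν hw γ hγ => ?_⟩
  have hγp := isProbabilityMeasure_of_mem_plans hγ.1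
  have hX := memLp_fst_of_mem_plans hμ hγ.1
  have hH : MemLp (fun p : E d × E d => p.2 - p.1) 2 γ :=
    (memLp_snd_of_mem_plans hν hγ.1).sub hX
  have hw0 : 0 ≤ W2 μ ν := W2_nonneg μ ν
  have hw2 := (W2_sq_of_mem_optimalPlans hγ).ge
  have hexp := energy_map_add_sub (P := γ) hW (X := Prod.fst) (H := fun p => p.2 - p.1)
    measurable_fst (by fun_prop) hX hH
  simp only [add_sub_cancel] at hexp
  rw [hγ.1.1, show (γ.map fun p : E d × E d => p.2) = ν from hγ.1.2] at hexp
  have hmap : (γ.prod γ).map (Prod.map Prod.fst Prod.fst) = μ.prod μ := by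
    rw [← Measure.map_prod_map _ _ measurable_fst measurable_fst, hγ.1.1]
  have hN : (γ.prod γ).real {q | 0 < ‖q.1.1 - q.2.1‖ ∧ ‖q.1.1 - q.2.1‖ ≤ η} ≤ τ ^ 2 := by
    refine le_of_eq_of_le ?_ hηN.le
    have hf : Measurable fun q : E d × E d => ‖q.1 - q.2‖ := by fun_prop
    have hm : MeasurableSet {q : E d × E d | 0 < ‖q.1 - q.2‖ ∧ ‖q.1 - q.2‖ ≤ η} :=
      (measurableSet_lt measurable_const hf).inter (measurableSet_le hf measurable_const)
    rw [← hmap, measureReal_def, measureReal_def, Measure.map_apply (by fun_prop) hm]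
    rfl
  have hlow := integral_remainder_ge hW hl' hl'' hF measurable_fst hX hH
    (hdiag.imp_left fun h => ae_prod_fst_ne h hγ.1.1) hη0 hτ0.le hw0 hN hw2
  rw [hexp]
  generalize W2 μ ν = w at *
  have hτb : 2 * l' * τ ≤ ε / 2 := by
    have : 2 * l' * τ = ε / 2 * (l' / (l' + 1)) := by rw [hτ]; field_simp; ring
    rw [this]
    have h1 : l' / (l' + 1) ≤ 1 := (div_le_one (by positivity)).2 (by linarith)
    nlinarith
  have hwb : (l'' + 2 * l' / η) * w ≤ ε / 2 := by
    have hpos : 0 < 2 * (l'' + 2 * l' / η + 1) := by positivity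
    have := (lt_div_iff₀ hpos).1 hw
    nlinarith
  have : w * ((l'' + 2 * l' / η) * w + 2 * l' * τ) ≤ w * ε :=
    mul_le_mul_of_nonneg_left (by linarith) hw0
  linarith

/-! ### Pairings with optimal plans and minimality of the norm. -/

lemma abs_integral_inner_plan_le {μ ν : Measure (E d)} (hμ : MemP2 μ) (hν : MemP2 ν)
    {v : E d → E d} (hv : MemLp v 2 μ) {γ : Measure (E d × E d)} (hγ : γ ∈ optimalPlans μ ν) :
    |∫ p, inner ℝ (v p.1) (p.2 - p.1) ∂γ| ≤ √(∫ x, ‖v x‖ ^ 2 ∂μ) * W2 μ ν := by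
  have hX := memLp_fst_of_mem_plans hμ hγ.1
  have hH : MemLp (fun p : E d × E d => p.2 - p.1) 2 γ :=
    (memLp_snd_of_mem_plans hν hγ.1).sub hX
  have hvγ : MemLp (fun p : E d × E d => v p.1) 2 γ := by
    rw [← hγ.1.1] at hv
    exact hv.comp_of_map measurable_fst.aemeasurable
  have h := abs_integral_inner_le hvγ hH
  have hv2 : ∫ p, ‖v p.1‖ ^ 2 ∂γ = ∫ x, ‖v x‖ ^ 2 ∂μ := by
    have hv' : AEStronglyMeasurable (fun x => ‖v x‖ ^ 2) (γ.map Prod.fst) := by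
      rw [hγ.1.1]; exact (hv.1.norm.pow 2)
    rw [← hγ.1.1, integral_map measurable_fst.aemeasurable hv']
  rwa [hv2, ← W2_sq_of_mem_optimalPlans hγ, Real.sqrt_sq (W2_nonneg _ _)] at h

lemma bddBelow_integral_inner_plan {μ ν : Measure (E d)} (hμ : MemP2 μ) (hν : MemP2 ν)
    {v : E d → E d} (hv : MemLp v 2 μ) :
    BddBelow ((fun γ : Measure (E d × E d) => ∫ p, inner ℝ (v p.1) (p.2 - p.1) ∂γ) ''
      optimalPlans μ ν) := by
  refine ⟨-(√(∫ x, ‖v x‖ ^ 2 ∂μ) * W2 μ ν), ?_⟩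
  rintro _ ⟨γ, hγ, rfl⟩
  exact (abs_le.1 (abs_integral_inner_plan_le hμ hν hv hγ)).1

lemma sInf_integral_inner_plan_ge {μ ν : Measure (E d)} (hμ : MemP2 μ) (hν : MemP2 ν)
    {v : E d → E d} (hv : MemLp v 2 μ) :
    -(√(∫ x, ‖v x‖ ^ 2 ∂μ) * W2 μ ν) ≤
      sInf ((fun γ : Measure (E d × E d) => ∫ p, inner ℝ (v p.1) (p.2 - p.1) ∂γ) ''
        optimalPlans μ ν) := by
  have := hμ.isProbabilityMeasure
  have := hν.isProbabilityMeasure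
  refine le_csInf ((optimalPlans_nonempty μ ν).image _) ?_
  rintro _ ⟨γ, hγ, rfl⟩
  exact (abs_le.1 (abs_integral_inner_plan_le hμ hν hv hγ)).1

/-- A field that satisfies the subgradient inequality along every optimal plan lies in the
subdifferential, and so does its midpoint with any other element. -/
lemma midpoint_mem_subdifferential {φ : Measure (E d) → ℝ} {μ : Measure (E d)} (hμ : MemP2 μ)
    {k v : E d → E d} (hk : MemLp k 2 μ)
    (hstrong : ∀ ε : ℝ, 0 < ε → ∃ δ : ℝ, 0 < δ ∧ ∀ ν : Measure (E d), MemP2 ν → W2 μ ν < δ →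
      ∀ γ ∈ optimalPlans μ ν,
        ∫ p, inner ℝ (k p.1) (p.2 - p.1) ∂γ - ε * W2 μ ν ≤ φ ν - φ μ)
    (hv : v ∈ subdifferential φ μ) :
    (fun x => (1 / 2 : ℝ) • (k x + v x)) ∈ subdifferential φ μ := by
  have hmid : MemLp (fun x => (1 / 2 : ℝ) • (k x + v x)) 2 μ :=
    (hk.add hv.1).const_smul (1 / 2 : ℝ)
  refine ⟨hmid, fun ε hε => ?_⟩
  obtain ⟨δ₁, hδ₁, h₁⟩ := hstrong ε hε
  obtain ⟨δ₂, hδ₂, h₂⟩ := hv.2 ε hε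
  refine ⟨min δ₁ δ₂, lt_min hδ₁ hδ₂, fun ν hν hw => ?_⟩
  have hs := h₁ ν hν (hw.trans_le (min_le_left _ _))
  have hi := h₂ ν hν (hw.trans_le (min_le_right _ _))
  have := hμ.isProbabilityMeasure
  have := hν.isProbabilityMeasure
  set J := fun γ : Measure (E d × E d) => ∫ p, inner ℝ (v p.1) (p.2 - p.1) ∂γ with hJ
  refine le_of_forall_pos_le_add fun ρ hρ => ?_
  -- The infima for `k` and `v` may be approached by different plans. A plan almost minimal for `v`
  -- is chosen, and the inequality for `k` holds along that same plan.
  obtain ⟨_, ⟨γ, hγ, rfl⟩, hlt⟩ := exists_lt_of_csInf_lt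
    ((optimalPlans_nonempty μ ν).image J) (lt_add_of_pos_right (sInf (J '' optimalPlans μ ν)) hρ)
  have hle := csInf_le (bddBelow_integral_inner_plan hμ hν hmid) (Set.mem_image_of_mem _ hγ)
  have hH : MemLp (fun p : E d × E d => p.2 - p.1) 2 γ :=
    (memLp_snd_of_mem_plans hν hγ.1).sub (memLp_fst_of_mem_plans hμ hγ.1)
  have hkγ : MemLp (fun p : E d × E d => k p.1) 2 γ := by
    rw [← hγ.1.1] at hk
    exact hk.comp_of_map measurable_fst.aemeasurable
  have hvγ : MemLp (fun p : E d × E d => v p.1) 2 γ := by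
    have := hv.1
    rw [← hγ.1.1] at this
    exact this.comp_of_map measurable_fst.aemeasurable
  have hsplit : ∫ p, inner ℝ ((1 / 2 : ℝ) • (k p.1 + v p.1)) (p.2 - p.1) ∂γ
      = 1 / 2 * (∫ p, inner ℝ (k p.1) (p.2 - p.1) ∂γ + J γ) := by
    simp_rw [inner_smul_left, inner_add_left]
    rw [integral_const_mul, integral_add (integrable_inner hkγ hH) (integrable_inner hvγ hH)]
    simp [hJ]
  simp only [hsplit] at hle
  have := hs γ hγ
  linarith

lemma mem_subdifferential_of_forall_plan {φ : Measure (E d) → ℝ} {μ : Measure (E d)}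
    (hμ : MemP2 μ) {k : E d → E d} (hk : MemLp k 2 μ)
    (hstrong : ∀ ε : ℝ, 0 < ε → ∃ δ : ℝ, 0 < δ ∧ ∀ ν : Measure (E d), MemP2 ν → W2 μ ν < δ →
      ∀ γ ∈ optimalPlans μ ν,
        ∫ p, inner ℝ (k p.1) (p.2 - p.1) ∂γ - ε * W2 μ ν ≤ φ ν - φ μ) :
    k ∈ subdifferential φ μ := by
  refine ⟨hk, fun ε hε => ?_⟩
  obtain ⟨δ, hδ, h⟩ := hstrong ε hε
  refine ⟨δ, hδ, fun ν hν hw => ?_⟩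
  have := hμ.isProbabilityMeasure
  have := hν.isProbabilityMeasure
  obtain ⟨γ, hγ⟩ := optimalPlans_nonempty μ ν
  have hle := csInf_le (bddBelow_integral_inner_plan hμ hν hk) (Set.mem_image_of_mem _ hγ)
  have := h ν hν hw γ hγ
  linarith

/-- Every element of the subdifferential has at least the norm of `field W μ`. -/
theorem integral_norm_sq_field_le (hW : IsAdmissible W) {μ : Measure (E d)} (hμ : MemP2 μ)
    {v : E d → E d} (hv : v ∈ subdifferential (energy W) μ) :
    ∫ x, ‖field W μ x‖ ^ 2 ∂μ ≤ ∫ x, ‖v x‖ ^ 2 ∂μ := by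
  have hμp := hμ.isProbabilityMeasure
  have hk := memLp_field hW hμ
  have hkm := measurable_field W μ
  set k := field W μ with hkdef
  set a := √(∫ x, ‖k x‖ ^ 2 ∂μ) with ha
  set b := √(∫ x, ‖v x‖ ^ 2 ∂μ) with hb
  have hk0 : 0 ≤ ∫ x, ‖k x‖ ^ 2 ∂μ := integral_nonneg fun x => by positivity
  have hv0 : 0 ≤ ∫ x, ‖v x‖ ^ 2 ∂μ := integral_nonneg fun x => by positivity
  have ha0 : 0 ≤ a := Real.sqrt_nonneg _
  have hb0 : 0 ≤ b := Real.sqrt_nonneg _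
  have ha2 : ∫ x, ‖k x‖ ^ 2 ∂μ = a ^ 2 := (Real.sq_sqrt hk0).symm
  have hb2 : ∫ x, ‖v x‖ ^ 2 ∂μ = b ^ 2 := (Real.sq_sqrt hv0).symm
  have key : ∀ ε : ℝ, 0 < ε → a ^ 2 ≤ (b + ε) * a + ε := by
    intro ε hε
    obtain ⟨δ, hδ, hsub⟩ := hv.2 ε hε
    -- Steepest descent: points move along `-k`.
    have hE := eventually_energy_le (P := μ) (X := fun x => x) (H := fun x => -k x) hW measurable_id
      hkm.neg hμ.memLp_id hk.neg hε
    have hsmall : ∀ᶠ t : ℝ in 𝓝[>] 0, t * a < δ := by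
      have : Tendsto (fun t : ℝ => t * a) (𝓝[>] 0) (𝓝 0) := by
        have h := (continuous_mul_const a).tendsto 0
        rw [zero_mul] at h
        exact h.mono_left nhdsWithin_le_nhds
      exact this.eventually (gt_mem_nhds hδ)
    obtain ⟨t, ht0, hEt, hta⟩ := ((eventually_mem_nhdsWithin).and (hE.and hsmall)).exists
    replace ht0 : 0 < t := ht0
    set ν := μ.map fun x => x + t • -k x with hν
    have hZm : Measurable fun x => x + t • -k x := by fun_prop
    have hZ : MemLp (fun x => x + t • -k x) 2 μ := hμ.memLp_id.add (hk.neg.const_smul t)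
    have hνP : MemP2 ν := memP2_map hZm hZ
    have hid : μ.map (fun x => x) = μ := Measure.map_id
    have hw2 := W2_sq_map_le measurable_id hZm hμ.memLp_id hZ
    have hw : W2 μ ν ≤ t * a := by
      refine abs_le_of_sq_le_sq' ?_ (by positivity) |>.2
      have h1 : ∫ x, ‖x + t • -k x - id x‖ ^ 2 ∂μ = (t * a) ^ 2 := by
        simp_rw [id, add_sub_cancel_left, norm_smul, norm_neg, mul_pow]
        rw [integral_const_mul, ha2, Real.norm_of_nonneg ht0.le]
      rw [h1, Measure.map_id] at hw2
      exact hw2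
    have hs := hsub ν hνP (hw.trans_lt hta)
    have hlow := sInf_integral_inner_plan_ge hμ hνP hv.1
    -- The displacement is a function of position, so coinciding points stay together and a cusp of
    -- `W` at the origin plays no role.
    have hdiag : ∫ q, Set.indicator {q : E d × E d | q.1 = q.2}
        (fun q => W (t • (-k q.1 - -k q.2))) q ∂(μ.prod μ) = 0 := by
      refine integral_eq_zero_of_ae (ae_of_all _ fun q => ?_)
      by_cases hq : q.1 = q.2
      · rw [Set.indicator_of_mem (show q ∈ {q : E d × E d | q.1 = q.2} from hq)]
        simp [hq, hW.zero]
      · exact Set.indicator_of_notMem (s := {q : E d × E d | q.1 = q.2}) hq _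
    have hin : ∫ x, inner ℝ (field W μ x) (-k x) ∂μ = -a ^ 2 := by
      simp_rw [inner_neg_right, ← hkdef, real_inner_self_eq_norm_sq]
      rw [integral_neg, ha2]
    rw [hid, hdiag, hin, mul_zero, add_zero] at hEt
    have h1 : (b + ε) * W2 μ ν ≤ (b + ε) * (t * a) := mul_le_mul_of_nonneg_left hw (by positivity)
    have h2 : t * a ^ 2 ≤ t * ((b + ε) * a + ε) := by nlinarith
    exact le_of_mul_le_mul_left h2 ht0
  have hlim : a ^ 2 ≤ b * a := by
    refine le_of_forall_pos_le_add fun ρ hρ => ?_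
    have := key (ρ / (a + 1)) (by positivity)
    have h1 : (b + ρ / (a + 1)) * a + ρ / (a + 1) = b * a + ρ := by field_simp; ring
    linarith
  rw [ha2, hb2]
  have hab : a ≤ b := by
    rcases ha0.eq_or_lt with h | h
    · rw [← h]; exact hb0
    · nlinarith
  exact pow_le_pow_left₀ ha0 hab 2

/-! ### Splitting an atom -/

/-- The law of a fair coin. -/
noncomputable def coin : Measure Bool :=
  (2⁻¹ : ℝ≥0∞) • (Measure.dirac true + Measure.dirac false)

instance : IsProbabilityMeasure coin := by
  constructor
  simp only [coin, Measure.smul_apply, Measure.add_apply, measure_univ, smul_eq_mul]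
  rw [one_add_one_eq_two, ENNReal.inv_mul_cancel (by simp) (by simp)]

lemma coin_singleton (b : Bool) : coin {b} = 2⁻¹ := by
  cases b <;> simp [coin]

lemma integral_coin (f : Bool → ℝ) : ∫ b, f b ∂coin = 1 / 2 * (f true + f false) := by
  rw [coin, integral_smul_measure, integral_add_measure Integrable.of_finite Integrable.of_finite,
    integral_dirac, integral_dirac]
  simp

open scoped Classical in
/-- The displacement that moves the atom at `x₀` by `z` or by `-z`. -/
noncomputable def splitting (x₀ z : E d) (ω : E d × Bool) : E d :=
  if ω.1 = x₀ then (if ω.2 then z else -z) else 0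

lemma measurable_splitting (x₀ z : E d) : Measurable (splitting x₀ z) := by
  classical
  refine Measurable.ite (measurable_fst (measurableSet_singleton x₀)) ?_ measurable_const
  exact (measurable_of_countable fun b : Bool => if b then z else -z).comp measurable_snd

lemma norm_splitting (x₀ z : E d) (ω : E d × Bool) :
    ‖splitting x₀ z ω‖ = Set.indicator {x₀} (fun _ => ‖z‖) ω.1 := by
  by_cases h : ω.1 = x₀
  · rw [Set.indicator_of_mem (by simpa using h), splitting, if_pos h]
    split_ifs <;> simp
  · rw [Set.indicator_of_notMem (by simpa using h), splitting, if_neg h, norm_zero]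

section

variable {μ : Measure (E d)} (x₀ z : E d)

lemma memLp_splitting [IsProbabilityMeasure μ] : MemLp (splitting x₀ z) 2 (μ.prod coin) := by
  refine MemLp.of_bound (measurable_splitting x₀ z).aestronglyMeasurable ‖z‖
    (ae_of_all _ fun ω => ?_)
  rw [norm_splitting]
  exact Set.indicator_le_self' (fun _ _ => norm_nonneg z) ω.1

lemma integral_norm_sq_splitting [IsProbabilityMeasure μ] :
    ∫ ω, ‖splitting x₀ z ω‖ ^ 2 ∂(μ.prod coin) = μ.real {x₀} * ‖z‖ ^ 2 := by
  have h : ∀ ω : E d × Bool, ‖splitting x₀ z ω‖ ^ 2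
      = Set.indicator {x₀} (fun _ => ‖z‖ ^ 2) ω.1 := by
    intro ω
    rw [norm_splitting]
    by_cases h : ω.1 = x₀ <;> simp [h]
  simp_rw [h]
  rw [integral_fun_fst (μ := μ) (ν := coin) (Set.indicator {x₀} fun _ => ‖z‖ ^ 2),
    integral_indicator_const _ (measurableSet_singleton x₀)]
  simp [-Bool.univ_eq]

lemma integral_inner_splitting [IsProbabilityMeasure μ] {f : E d → E d} (hf : MemLp f 2 μ) :
    ∫ ω, inner ℝ (f ω.1) (splitting x₀ z ω) ∂(μ.prod coin) = 0 := by
  rw [integral_prod _ (integrable_inner (hf.comp_fst coin) (memLp_splitting x₀ z))]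
  refine integral_eq_zero_of_ae (ae_of_all _ fun x => ?_)
  simp only [integral_coin, Pi.zero_apply]
  by_cases h : x = x₀ <;> simp [splitting, h]

/-- The two halves of the atom land on the bounding sphere, outside the open ball; all other points
are fixed. -/
lemma measure_ball_splitting_le [IsProbabilityMeasure μ] {t : ℝ} (ht : 0 < t) :
    ((μ.prod coin).map fun ω => ω.1 + t • splitting x₀ z ω).real (Metric.ball x₀ (t * ‖z‖))
      ≤ μ.real {x | 0 < ‖x - x₀‖ ∧ ‖x - x₀‖ ≤ t * ‖z‖} := by
  have hm : Measurable fun ω : E d × Bool => ω.1 + t • splitting x₀ z ω :=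
    measurable_fst.add ((measurable_splitting x₀ z).const_smul t)
  rw [map_measureReal_apply hm measurableSet_ball]
  have hfst : (μ.prod coin).real (Prod.fst ⁻¹' {x | 0 < ‖x - x₀‖ ∧ ‖x - x₀‖ ≤ t * ‖z‖})
      = μ.real {x | 0 < ‖x - x₀‖ ∧ ‖x - x₀‖ ≤ t * ‖z‖} := by
    have hf : Measurable fun x : E d => ‖x - x₀‖ := by fun_prop
    have hS : MeasurableSet {x : E d | 0 < ‖x - x₀‖ ∧ ‖x - x₀‖ ≤ t * ‖z‖} :=
      (measurableSet_lt measurable_const hf).inter (measurableSet_le hf measurable_const)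
    rw [← map_measureReal_apply measurable_fst hS, Measure.map_fst_prod, measure_univ, one_smul]
  rw [← hfst]
  refine measureReal_mono fun ω hω => ?_
  rw [Set.mem_preimage, mem_ball_iff_norm] at hω
  by_cases h : ω.1 = x₀
  · exfalso
    rw [h, add_sub_cancel_left, norm_smul, norm_splitting,
      Set.indicator_of_mem (by simpa using h), Real.norm_of_nonneg ht.le] at hω
    exact lt_irrefl _ hω
  · rw [splitting, if_neg h, smul_zero, add_zero] at hω
    exact ⟨norm_pos_iff.2 (sub_ne_zero.2 h), hω.le⟩

/-- The pairs of copies of the atom that the splitting moves apart. -/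
def splitPairs (x₀ : E d) : Set ((E d × Bool) × (E d × Bool)) :=
  {q | q.1.1 = x₀ ∧ q.2.1 = x₀ ∧ q.1.2 ≠ q.2.2}

lemma measurableSet_splitPairs : MeasurableSet (splitPairs x₀) := by
  refine (measurableSet_eq_fun (by fun_prop) measurable_const).inter
    ((measurableSet_eq_fun (by fun_prop) measurable_const).inter
      (measurableSet_eq_fun (by fun_prop) (by fun_prop)).compl)

lemma measureReal_splitPairs_pos [IsProbabilityMeasure μ] (hx₀ : μ {x₀} ≠ 0) :
    0 < ((μ.prod coin).prod (μ.prod coin)).real (splitPairs x₀) := by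
  refine ENNReal.toReal_pos (fun h0 => ?_) (measure_ne_top _ _)
  refine absurd (measure_mono_null (s := ({x₀} ×ˢ {true}) ×ˢ ({x₀} ×ˢ {false})) ?_ h0) ?_
  · rintro ⟨⟨x, b⟩, ⟨y, c⟩⟩ h
    simp only [Set.mem_prod, Set.mem_singleton_iff] at h
    exact ⟨h.1.1, h.2.1, by simp [h.1.2, h.2.2]⟩
  · rw [Measure.prod_prod, Measure.prod_prod, Measure.prod_prod, coin_singleton, coin_singleton]
    simp [hx₀]

/-- Among coinciding pairs, only opposite halves of the atom separate, by `(2 * t) • z` up to sign;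
evenness removes the sign. -/
lemma integral_diagonal_splitting (hW : IsAdmissible W) (t : ℝ) :
    ∫ q, Set.indicator {q : (E d × Bool) × (E d × Bool) | q.1.1 = q.2.1}
      (fun q => W (t • (splitting x₀ z q.1 - splitting x₀ z q.2))) q
        ∂((μ.prod coin).prod (μ.prod coin))
      = ((μ.prod coin).prod (μ.prod coin)).real (splitPairs x₀) * W ((2 * t) • z) := by
  have h : (Set.indicator {q : (E d × Bool) × (E d × Bool) | q.1.1 = q.2.1}
      fun q => W (t • (splitting x₀ z q.1 - splitting x₀ z q.2)))
      = (splitPairs x₀).indicator fun _ => W ((2 * t) • z) := by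
    funext q
    obtain ⟨⟨x, b⟩, ⟨y, c⟩⟩ := q
    have h2 : t • (z - -z) = (2 * t) • z := by
      rw [sub_neg_eq_add, ← two_smul ℝ z, smul_smul, mul_comm]
    have h3 : W (t • (-z - z)) = W ((2 * t) • z) := by
      rw [← hW.even, ← smul_neg, neg_sub, sub_neg_eq_add, ← two_smul ℝ z, smul_smul, mul_comm]
    by_cases hxy : x = y
    · subst hxy
      rw [Set.indicator_of_mem (show ((x, b), (x, c)) ∈
        {q : (E d × Bool) × (E d × Bool) | q.1.1 = q.2.1} from rfl)]
      by_cases hx : x = x₀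
      · by_cases hbc : b = c
        · rw [Set.indicator_of_notMem (fun hmem => hmem.2.2 hbc)]
          simp [hbc, hW.zero]
        · rw [Set.indicator_of_mem (show ((x, b), (x, c)) ∈ splitPairs x₀ from ⟨hx, hx, hbc⟩)]
          cases b <;> cases c <;> simp_all [splitting]
      · rw [Set.indicator_of_notMem (fun hmem => hx hmem.1)]
        simp [splitting, hx, hW.zero]
    · rw [Set.indicator_of_notMem (s := {q : (E d × Bool) × (E d × Bool) | q.1.1 = q.2.1}) hxy,
        Set.indicator_of_notMem (fun hmem => hxy (hmem.1.trans hmem.2.1.symm))]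
  rw [h, integral_indicator_const _ (measurableSet_splitPairs x₀), smul_eq_mul]

end

/-- All of the atom except mass at most `C` must leave the ball of radius `r`, which already uses
the cost budget `μ.real {x₀} * r ^ 2` up to `C * r ^ 2`. No knowledge of the plan's structure is
needed. -/
lemma integral_offAtom_le {μ ν : Measure (E d)} (hμ : MemP2 μ) (hν : MemP2 ν) (x₀ : E d)
    {γ : Measure (E d × E d)} (hγ : γ ∈ plans μ ν) {r C : ℝ} (hr : 0 ≤ r)
    (hC : ∫ p, ‖p.2 - p.1‖ ^ 2 ∂γ ≤ μ.real {x₀} * r ^ 2)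
    (hball : ν.real (Metric.ball x₀ r) ≤ C) :
    ∫ p in {p : E d × E d | p.1 = x₀}ᶜ, ‖p.2 - p.1‖ ^ 2 ∂γ ≤ C * r ^ 2 := by
  have := hμ.isProbabilityMeasure
  have := hν.isProbabilityMeasure
  have := isProbabilityMeasure_of_mem_plans hγ
  have hH : MemLp (fun p : E d × E d => p.2 - p.1) 2 γ :=
    (memLp_snd_of_mem_plans hν hγ).sub (memLp_fst_of_mem_plans hμ hγ)
  have hint := integrable_norm_sq hH
  set S : Set (E d × E d) := {p | p.1 = x₀} with hS
  have hSm : MeasurableSet S := measurable_fst (measurableSet_singleton x₀)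
  have hsplit := integral_add_compl hSm hint
  set B : Set (E d × E d) := Prod.snd ⁻¹' Metric.ball x₀ r with hB
  have hBm : MeasurableSet B := measurable_snd measurableSet_ball
  have hγS : γ.real S = μ.real {x₀} := by
    rw [← hγ.1, map_measureReal_apply measurable_fst (measurableSet_singleton x₀)]; rfl
  have hγB : γ.real B = ν.real (Metric.ball x₀ r) := by
    rw [← hγ.2, map_measureReal_apply measurable_snd measurableSet_ball]
  have hdiff : γ.real S ≤ γ.real (S \ B) + γ.real B := by
    refine (measureReal_mono ?_).trans (measureReal_union_le _ _)
    intro p hp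
    by_cases h : p ∈ B
    · exact Or.inr h
    · exact Or.inl ⟨hp, h⟩
  have hlow : γ.real (S \ B) * r ^ 2 ≤ ∫ p in S, ‖p.2 - p.1‖ ^ 2 ∂γ := by
    calc γ.real (S \ B) * r ^ 2 = ∫ _ in S \ B, r ^ 2 ∂γ := by simp
      _ ≤ ∫ p in S \ B, ‖p.2 - p.1‖ ^ 2 ∂γ := by
          refine setIntegral_mono_on (integrable_const _) hint.integrableOn (hSm.diff hBm) ?_
          intro p hp
          have h1 : p.1 = x₀ := hp.1
          have h2 : ¬ ‖p.2 - x₀‖ < r := fun h => hp.2 (mem_ball_iff_norm.2 h)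
          rw [h1]
          exact pow_le_pow_left₀ hr (not_lt.1 h2) 2
      _ ≤ ∫ p in S, ‖p.2 - p.1‖ ^ 2 ∂γ :=
          setIntegral_mono_set hint.integrableOn (ae_of_all _ fun p => by positivity)
            (Set.sdiff_subset.eventuallyLE)
  have hm : (γ.real S - C) * r ^ 2 ≤ γ.real (S \ B) * r ^ 2 :=
    mul_le_mul_of_nonneg_right (by linarith) (by positivity)
  rw [← hγS] at hC
  nlinarith

/-- Because the mean displacement is orthogonal to `v x₀`, that constant may be subtracted from `v`.
The integrand then vanishes on the mass starting at `x₀`, and Cauchy–Schwarz applies to the rest. -/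
lemma integral_inner_plan_ge_of_offAtom {μ ν : Measure (E d)} (hμ : MemP2 μ) (hν : MemP2 ν)
    (x₀ : E d) {v : E d → E d} (hv : MemLp v 2 μ) {γ : Measure (E d × E d)}
    (hγ : γ ∈ plans μ ν) {s : ℝ} (hs : 0 ≤ s)
    (hbar : ∫ p, inner ℝ (v x₀) (p.2 - p.1) ∂γ = 0)
    (hoff : ∫ p in {p : E d × E d | p.1 = x₀}ᶜ, ‖p.2 - p.1‖ ^ 2 ∂γ ≤ s ^ 2) :
    -(√(∫ x, ‖v x - v x₀‖ ^ 2 ∂μ) * s) ≤ ∫ p, inner ℝ (v p.1) (p.2 - p.1) ∂γ := by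
  have := hμ.isProbabilityMeasure
  have := isProbabilityMeasure_of_mem_plans hγ
  have hH : MemLp (fun p : E d × E d => p.2 - p.1) 2 γ :=
    (memLp_snd_of_mem_plans hν hγ).sub (memLp_fst_of_mem_plans hμ hγ)
  set S : Set (E d × E d) := {p | p.1 = x₀} with hS
  have hSm : MeasurableSet S := measurable_fst (measurableSet_singleton x₀)
  have hu : MemLp (fun x => v x - v x₀) 2 μ := hv.sub (memLp_const _)
  have huγ : MemLp (fun p : E d × E d => v p.1 - v x₀) 2 γ := by
    rw [← hγ.1] at hu
    exact hu.comp_of_map measurable_fst.aemeasurable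
  have hvγ : MemLp (fun p : E d × E d => v p.1) 2 γ := by
    rw [← hγ.1] at hv
    exact hv.comp_of_map measurable_fst.aemeasurable
  have hu2 : ∫ p, ‖v p.1 - v x₀‖ ^ 2 ∂γ = ∫ x, ‖v x - v x₀‖ ^ 2 ∂μ := by
    have hu' : AEStronglyMeasurable (fun x => ‖v x - v x₀‖ ^ 2) (γ.map Prod.fst) := by
      rw [hγ.1]; exact (hu.1.norm.pow 2)
    rw [← hγ.1, integral_map measurable_fst.aemeasurable hu']
  set Hc : E d × E d → E d := Sᶜ.indicator fun p => p.2 - p.1 with hHc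
  have hHcL : MemLp Hc 2 γ := hH.indicator hSm.compl
  have hHc2 : ∫ p, ‖Hc p‖ ^ 2 ∂γ ≤ s ^ 2 := by
    refine le_of_eq_of_le ?_ hoff
    rw [← integral_indicator hSm.compl]
    refine integral_congr_ae (ae_of_all _ fun p => ?_)
    by_cases hp : p ∈ S <;> simp [Hc, hp]
  have heq : ∫ p, inner ℝ (v p.1) (p.2 - p.1) ∂γ = ∫ p, inner ℝ (v p.1 - v x₀) (Hc p) ∂γ := by
    rw [← sub_zero (∫ p, inner ℝ (v p.1) (p.2 - p.1) ∂γ), ← hbar,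
      ← integral_sub (integrable_inner hvγ hH) (integrable_inner (memLp_const _) hH)]
    refine integral_congr_ae (ae_of_all _ fun p => ?_)
    by_cases hp : p ∈ S
    · have hp' : p.1 = x₀ := hp
      simp [Hc, hp, hp']
    · simp [Hc, hp, inner_sub_left]
  have hcs := abs_integral_inner_le huγ hHcL
  rw [hu2, ← heq] at hcs
  have hsq : √(∫ p, ‖Hc p‖ ^ 2 ∂γ) ≤ s := by
    rw [Real.sqrt_le_left hs]; exact hHc2
  have := mul_le_mul_of_nonneg_left hsq (Real.sqrt_nonneg (∫ x, ‖v x - v x₀‖ ^ 2 ∂μ))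
  have := (abs_le.1 hcs).1
  linarith

/-- If the subdifferential is nonempty at a measure with an atom, then the potential has no
negative cusp at the origin. -/
theorem potential_ge_of_atom (hW : IsAdmissible W) {μ : Measure (E d)} (hμ : MemP2 μ)
    {l' l'' : ℝ} (hl'' : 0 ≤ l'')
    (hF : ConvexOn ℝ Set.univ (fun x => W x + l'' / 2 * ‖x‖ ^ 2 + l' * ‖x‖))
    {v : E d → E d} (hv : v ∈ subdifferential (energy W) μ) {x₀ : E d} (hx₀ : μ {x₀} ≠ 0)
    (z : E d) : -(l'' / 2 * ‖z‖ ^ 2) ≤ W z := by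
  have hμp := hμ.isProbabilityMeasure
  by_contra hz
  obtain ⟨c, hc, hlin⟩ := hW.exists_linear_upper_bound hl'' hF (not_le.1 hz)
  have hz0 : 0 < ‖z‖ := by
    refine norm_pos_iff.2 fun h => hz ?_
    simp [h, hW.zero]
  set P := μ.prod coin with hP
  set H := splitting x₀ z with hHdef
  have hPX : P.map Prod.fst = μ := by simp [hP, -Bool.univ_eq]
  have hXL : MemLp (fun ω : E d × Bool => ω.1) 2 P := hμ.memLp_id.comp_fst coin
  have hHL : MemLp H 2 P := memLp_splitting x₀ z
  have hHm : Measurable H := measurable_splitting x₀ z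
  set N := (P.prod P).real (splitPairs x₀) with hN
  have hN0 : 0 < N := measureReal_splitPairs_pos x₀ hx₀
  set M := √(∫ x, ‖v x - v x₀‖ ^ 2 ∂μ) with hM
  have hM0 : 0 ≤ M := Real.sqrt_nonneg _
  -- The energy drops by at least `N * c * t`, up to an error `ε * t`. This `ε` makes the two error
  -- terms, `ε * t` and `ε * W2 μ ν`, use at most half of the drop; the pairing term stays strictly
  -- below the other half.
  set ε := N * c / (2 * (‖z‖ + 1)) with hε
  have hε0 : 0 < ε := by positivity
  obtain ⟨δ, hδ, hsub⟩ := hv.2 ε hε0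
  have hE := eventually_energy_le (P := P) (X := Prod.fst) (H := H) hW measurable_fst hHm hXL hHL
    hε0
  have hid : Tendsto (fun t : ℝ => t * ‖z‖) (𝓝[>] 0) (𝓝[>] 0) := by
    refine tendsto_nhdsWithin_iff.2 ⟨?_, ?_⟩
    · have h := (continuous_mul_const ‖z‖).tendsto 0
      rw [zero_mul] at h
      exact h.mono_left nhdsWithin_le_nhds
    · filter_upwards [self_mem_nhdsWithin] with t ht
      exact mul_pos ht hz0
  have hω := (tendsto_measureReal_pos_le (P := μ) (f := fun x => ‖x - x₀‖) (by fun_prop)).comp hid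
  have hrhs : Tendsto (fun t : ℝ => M * (√(μ.real {x | 0 < ‖x - x₀‖ ∧ ‖x - x₀‖ ≤ t * ‖z‖}) * ‖z‖))
      (𝓝[>] 0) (𝓝 0) := by
    have h := ((Real.continuous_sqrt.tendsto 0).comp hω).mul_const ‖z‖ |>.const_mul M
    simpa [Function.comp_def] using h
  have hNc : 0 < N * c / 2 := by positivity
  -- The restriction `t < 1 / 2` keeps the separation parameter `2 * t` in the range of the linear
  -- bound on `W`.
  obtain ⟨t, ht0, ht1, htδ, hEt, hrt⟩ := ((eventually_mem_nhdsWithin (a := (0 : ℝ))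
    (s := Set.Ioi 0)).and ((eventually_mem_set.2 (Ioo_mem_nhdsGT (by norm_num : (0 : ℝ) < 1 / 2))).and
    (((tendsto_nhdsWithin_iff.1 hid).1.eventually (gt_mem_nhds hδ)).and
      (hE.and (hrhs.eventually (gt_mem_nhds hNc)))))).exists
  replace ht0 : 0 < t := ht0
  rw [hPX] at hEt
  set ν := P.map fun ω => ω.1 + t • H ω with hνdef
  have hZm : Measurable fun ω : E d × Bool => ω.1 + t • H ω :=
    measurable_fst.add (hHm.const_smul t)
  have hZ : MemLp (fun ω : E d × Bool => ω.1 + t • H ω) 2 P := hXL.add (hHL.const_smul t)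
  have hνP : MemP2 ν := memP2_map hZm hZ
  have hw2 : W2 μ ν ^ 2 ≤ μ.real {x₀} * (t * ‖z‖) ^ 2 := by
    have h := W2_sq_map_le measurable_fst hZm hXL hZ
    simp_rw [add_sub_cancel_left, norm_smul, mul_pow] at h
    rw [integral_const_mul, integral_norm_sq_splitting, hPX, Real.norm_of_nonneg ht0.le] at h
    refine h.trans_eq (by ring)
  have hw : W2 μ ν ≤ t * ‖z‖ := by
    refine (abs_le_of_sq_le_sq' (hw2.trans ?_) (by positivity)).2
    exact mul_le_of_le_one_left (by positivity) measureReal_le_one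
  have hs := hsub ν hνP (hw.trans_lt htδ)
  set ω := μ.real {x | 0 < ‖x - x₀‖ ∧ ‖x - x₀‖ ≤ t * ‖z‖} with hωdef
  have hω0 : 0 ≤ ω := measureReal_nonneg
  have hball : ν.real (Metric.ball x₀ (t * ‖z‖)) ≤ ω := measure_ball_splitting_le x₀ z ht0
  have hlow : -(M * (√ω * (t * ‖z‖))) ≤
      sInf ((fun γ : Measure (E d × E d) => ∫ p, inner ℝ (v p.1) (p.2 - p.1) ∂γ) ''
        optimalPlans μ ν) := by
    have := hνP.isProbabilityMeasure
    refine le_csInf ((optimalPlans_nonempty μ ν).image _) ?_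
    rintro _ ⟨γ, hγ, rfl⟩
    have hγp := isProbabilityMeasure_of_mem_plans hγ.1
    refine integral_inner_plan_ge_of_offAtom hμ hνP x₀ hv.1 hγ.1 (by positivity) ?_ ?_
    · have hi1 : Integrable (fun p : E d × E d => inner ℝ (v x₀) p.2) γ :=
        integrable_inner (memLp_const _) (memLp_snd_of_mem_plans hνP hγ.1)
      have hi2 : Integrable (fun p : E d × E d => inner ℝ (v x₀) p.1) γ :=
        integrable_inner (memLp_const _) (memLp_fst_of_mem_plans hμ hγ.1)
      have hc' : Continuous fun y : E d => (inner ℝ (v x₀) y : ℝ) := by fun_prop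
      have h1 : ∫ p, inner ℝ (v x₀) p.2 ∂γ = ∫ y, inner ℝ (v x₀) y ∂ν := by
        rw [← hγ.1.2, integral_map measurable_snd.aemeasurable hc'.aestronglyMeasurable]
      have h2 : ∫ p, inner ℝ (v x₀) p.1 ∂γ = ∫ y, inner ℝ (v x₀) y ∂μ := by
        rw [← hγ.1.1, integral_map measurable_fst.aemeasurable hc'.aestronglyMeasurable]
      have h3 : ∫ y, inner ℝ (v x₀) y ∂ν = ∫ y, inner ℝ (v x₀) y ∂μ := by
        have hj1 : Integrable (fun q : E d × Bool => inner ℝ (v x₀) q.1) P :=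
          integrable_inner (memLp_const _) hXL
        have hj2 : Integrable (fun q => inner ℝ (v x₀) (H q)) P :=
          integrable_inner (memLp_const _) hHL
        rw [hνdef, integral_map hZm.aemeasurable hc'.aestronglyMeasurable]
        simp_rw [inner_add_right, inner_smul_right]
        rw [integral_add hj1 (hj2.const_mul t), integral_const_mul,
          integral_inner_splitting x₀ z (f := fun _ => v x₀) (memLp_const _), mul_zero, add_zero]
        conv_rhs => rw [← hPX]
        rw [integral_map measurable_fst.aemeasurable hc'.aestronglyMeasurable]
      simp_rw [inner_sub_right]
      rw [integral_sub hi1 hi2, h1, h2, h3, sub_self]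
    · rw [mul_pow, Real.sq_sqrt hω0]
      refine integral_offAtom_le hμ hνP x₀ hγ.1 (by positivity) ?_ hball
      rw [← W2_sq_of_mem_optimalPlans hγ]
      exact hw2
  have hlinear : ∫ q, inner ℝ (field W μ q.1) (H q) ∂P = 0 :=
    integral_inner_splitting x₀ z (memLp_field hW hμ)
  rw [hlinear, integral_diagonal_splitting x₀ z hW, mul_zero, zero_add] at hEt
  have hWt : N * W ((2 * t) • z) ≤ N * -(c * (2 * t)) :=
    mul_le_mul_of_nonneg_left (hlin (2 * t) (by positivity) (by linarith [ht1.2])) hN0.le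
  have hεz : ε * (‖z‖ + 1) = N * c / 2 := by rw [hε]; field_simp
  have h1 : ε * W2 μ ν ≤ ε * (t * ‖z‖) := mul_le_mul_of_nonneg_left hw hε0.le
  have h2 : t * (N * c) ≤ t * (M * (√ω * ‖z‖) + ε * (‖z‖ + 1)) := by
    change _ ≤ 1 / 2 * (N * W ((2 * t) • z)) + ε * t at hEt
    linarith
  have h3 := le_of_mul_le_mul_left h2 ht0
  linarith

/-! ### The equality case and the conclusion. -/

lemma eLpNorm_two_eq {Ω : Type*} [MeasurableSpace Ω] {P : Measure Ω} {f : Ω → E d}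
    (hf : MemLp f 2 P) : eLpNorm f 2 P = ENNReal.ofReal √(∫ ω, ‖f ω‖ ^ 2 ∂P) := by
  rw [hf.eLpNorm_eq_integral_rpow_norm (by simp) (by simp)]
  simp [Real.sqrt_eq_rpow]

/-- Two fields of equal norm whose midpoint has no smaller norm coincide. -/
lemma ae_eq_of_norm_midpoint_ge {μ : Measure (E d)} {k v : E d → E d} (hk : MemLp k 2 μ)
    (hv : MemLp v 2 μ) (heq : ∫ x, ‖v x‖ ^ 2 ∂μ = ∫ x, ‖k x‖ ^ 2 ∂μ)
    (hmid : ∫ x, ‖k x‖ ^ 2 ∂μ ≤ ∫ x, ‖(1 / 2 : ℝ) • (k x + v x)‖ ^ 2 ∂μ) : v =ᵐ[μ] k := by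
  have hm : MemLp (fun x => (1 / 2 : ℝ) • (k x + v x)) 2 μ := (hk.add hv).const_smul (1 / 2 : ℝ)
  have hd : MemLp (fun x => v x - k x) 2 μ := hv.sub hk
  have hpar : ∀ x, ‖v x - k x‖ ^ 2
      = 2 * ‖v x‖ ^ 2 + 2 * ‖k x‖ ^ 2 - 4 * ‖(1 / 2 : ℝ) • (k x + v x)‖ ^ 2 := by
    intro x
    have := parallelogram_law_with_norm ℝ (v x) (k x)
    rw [norm_smul, add_comm (k x)]
    norm_num
    nlinarith
  have hint : ∫ x, ‖v x - k x‖ ^ 2 ∂μ ≤ 0 := by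
    simp_rw [hpar]
    have hi : Integrable (fun x => 2 * ‖v x‖ ^ 2 + 2 * ‖k x‖ ^ 2) μ :=
      ((integrable_norm_sq hv).const_mul 2).add ((integrable_norm_sq hk).const_mul 2)
    rw [integral_sub hi ((integrable_norm_sq hm).const_mul 4),
      integral_add ((integrable_norm_sq hv).const_mul 2) ((integrable_norm_sq hk).const_mul 2),
      integral_const_mul, integral_const_mul, integral_const_mul]
    linarith
  have h0 : ∫ x, ‖v x - k x‖ ^ 2 ∂μ = 0 :=
    le_antisymm hint (integral_nonneg fun x => by positivity)
  have hae := (integral_eq_zero_iff_of_nonneg (fun x => by positivity)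
    (integrable_norm_sq hd)).1 h0
  filter_upwards [hae] with x hx
  simpa [sub_eq_zero] using hx

end InteractionEnergy

open InteractionEnergy in
theorem mainTheorem8 (d : ℕ) (W : InteractionEnergy.E d → ℝ)
    (hW : InteractionEnergy.IsAdmissible W)
    (μ : MeasureTheory.Measure (InteractionEnergy.E d)) (hμ : InteractionEnergy.MemP2 μ)
    (hne : (InteractionEnergy.subdifferential (InteractionEnergy.energy W) μ).Nonempty) :
    (∀ x, MeasureTheory.IntegrableOn (fun y => gradient W (x - y)) {x}ᶜ μ) ∧
    InteractionEnergy.field W μ ∈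
      InteractionEnergy.subdifferential (InteractionEnergy.energy W) μ ∧
    ∀ v ∈ InteractionEnergy.subdifferential (InteractionEnergy.energy W) μ,
      MeasureTheory.eLpNorm (InteractionEnergy.field W μ) 2 μ ≤ MeasureTheory.eLpNorm v 2 μ ∧
      (MeasureTheory.eLpNorm v 2 μ = MeasureTheory.eLpNorm (InteractionEnergy.field W μ) 2 μ →
        v =ᵐ[μ] InteractionEnergy.field W μ) := by
  obtain ⟨l', l'', hl', hl'', hF⟩ := hW.convex
  obtain ⟨v₀, hv₀⟩ := hne
  have hk := memLp_field hW hμ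
  -- For membership of the field, nonemptiness of the subdifferential enters only here, to exclude a
  -- negative cusp in the presence of atoms.
  have hdiag : (∀ x, μ {x} = 0) ∨ ∀ z, -(l'' / 2 * ‖z‖ ^ 2) ≤ W z := by
    by_cases h : ∀ x, μ {x} = 0
    · exact Or.inl h
    · obtain ⟨x₀, hx₀⟩ := not_forall.1 h
      exact Or.inr fun z => potential_ge_of_atom hW hμ hl'' hF hv₀ hx₀ z
  have hstrong := fun ε hε => energy_sub_ge_of_optimalPlan hW hμ hl' hl'' hF hdiag (ε := ε) hε
  refine ⟨integrableOn_gradient_sub hW hμ, mem_subdifferential_of_forall_plan hμ hk hstrong,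
    fun v hv => ⟨?_, fun heq => ?_⟩⟩
  · rw [eLpNorm_two_eq hk, eLpNorm_two_eq hv.1]
    exact ENNReal.ofReal_le_ofReal (Real.sqrt_le_sqrt (integral_norm_sq_field_le hW hμ hv))
  · refine ae_eq_of_norm_midpoint_ge hk hv.1 ?_
      (integral_norm_sq_field_le hW hμ (midpoint_mem_subdifferential hμ hk hstrong hv))
    rw [eLpNorm_two_eq hk, eLpNorm_two_eq hv.1, ENNReal.ofReal_eq_ofReal_iff
      (Real.sqrt_nonneg _) (Real.sqrt_nonneg _), Real.sqrt_inj
      (integral_nonneg fun x => by positivity) (integral_nonneg fun x => by positivity)] at heq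
    exact heq
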